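/- **Setting.** Let $n\ge 1$ players $i\in\{1,\dots,n\}$ have action sets $\Omega_i\subset\mathbb R^{m_1}$, nonempty, convex and compact, and let $\Omega=\Omega_1\times\cdots\times\Omega_n$. Let $J_i,g_i:\mathbb R^{m_1}\times\mathbb R^{m_2}\to\mathbb R$. For $x_i\in\Omega_i$ and $y\in\mathbb R^{m_2}$ suppose that the partial gradients $\nabla_1J_i,\nabla_2J_i,\nabla_2g_i$ and the derivatives $\nabla_{21}g_i$ (the $m_1\times m_2$ matrix of mixed second derivatives) and $\nabla_{22}g_i$ (the Hessian in $y$) exist, and that $g_i(x_i,\cdot)$ is $\mu$-strongly convex, with one $\mu>0$ for all $i$. Let $\sigma(x)=\arg\min_y\sum_{i=1}^n g_i(x_i,y)$ for $x\in\Omega$, and suppose that $u\mapsto J_i(u,\sigma(u,x_{-i}))$ is convex on $\Omega_i$ for all $i$ and $x\in\Omega$. Suppose that for some $L>0$ the maps $\nabla_1J_i,\nabla_2J_i,\nabla_2g_i,\nabla_{21}g_i,\nabla_{22}g_i$ are $L$-Lipschitz in each argument on $\Omega_i\times\mathbb R^{m_2}$ (Frobenius norm for matrices), and that for some $\theta>0$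 the pseudo-gradient $F(x)=(\nabla_{x_i}J_i(x_i,\sigma(x)))_{i}$ satisfies $\langle F(x)-F(x'),x-x'\rangle\ge\theta\|x-x'\|^2$ for all $x,x'\in\Omega$. A pair $(x^*,y^*)$ with $x^*\in\Omega$ is a Stackelberg equilibrium if $J_i(x_i^*,\sigma(x^*))\le J_i(u,\sigma(u,x_{-i}^*))$ for all $i$ and $u\in\Omega_i$, and $y^*$ minimizes $\sum_i g_i(x_i^*,\cdot)$. Let $A=(a_{ij})$ be a symmetric $n\times n$ matrix with nonnegative entries, $A\mathbf 1=\mathbf 1$, whose graph (distinct $i,j$ adjacent iff $a_{ij}\ne0$) is connected, and which does not have $-1$ as an eigenvalue. Let $\lambda_n(I-A)$ be the largest eigenvalue of $I-A$. **Algorithm.** Start from arbitrary $x_{i,0}\in\Omega_i$, $y_{i,0},z_{i,0}\in\mathbb R^{m_2}$, with $\lambda_{i,0}=0$ and $v_{i,0}=\nabla_{22}g_i(x_{i,0},y_{i,0})$. For $t=0,1,2,\dots$ let $$y_{i,t+1}=y_{i,t}+\kappa\Big(\sum_j a_{ij}\lambda_{j,t}-\lambda_{i,t}-\nabla_2g_i(x_{i,t},y_{i,t})\Big),\qquad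 \lambda_{i,t+1}=\lambda_{i,t}-\kappa\Big(\sum_j a_{ij}y_{j,t+1}-y_{i,t+1}\Big),$$ $$v_{i,t+1}=\sum_j a_{ij}v_{j,t}+\nabla_{22}g_i(x_{i,t+1},y_{i,t+1})-\nabla_{22}g_i(x_{i,t},y_{i,t}),\qquad z_{i,t+1}=z_{i,t}-\alpha\big(n\,v_{i,t}z_{i,t}+\nabla_2J_i(x_{i,t},y_{i,t})\big),$$ $$x_{i,t+1}=(1-\eta_t)x_{i,t}+\eta_t P_{\Omega_i}\big[x_{i,t}-k\big(\nabla_1J_i(x_{i,t},y_{i,t})+\nabla_{21}g_i(x_{i,t},y_{i,t})z_{i,t}\big)\big],\qquad \eta_t=\frac{b}{t+a},$$ where $P_{\Omega_i}$ is the Euclidean projection. Let $K_0>0$ and $K_1,K_3$ be bounds such that, for all $i$, $\|\nabla_{22}g_i\|_{\mathbb F}\le K_0$ at the points $(x_{i,t},y_{i,t})$, $t\ge0$, and $\|\nabla_2J_i(x_i,\sigma(x))\|\le K_1$, $\|\nabla_{21}g_i(x_i,\sigma(x))\|_{\mathbb F}\le K_3$ for $x\in\Omega$. Put $\ell=K_3/(\sqrt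 n\,\mu)$ and $$L_0=\frac{nL\big(K_1(K_3+\mu+K_3\ell+\mu\ell)+(K_3\mu+\mu^2)(1+\ell)\big)}{\mu^2}.$$ **Theorem 1.** Suppose $0<\kappa<\min\big(\tfrac1L,\tfrac{\mu}{\lambda_n(I-A)^2}\big)$ (with $\mu/0=\infty$), $0<\alpha<\frac{\mu}{2nK_0^2}$, $0<k<\frac{\theta}{L_0}$, $b\ge\max\big(\tfrac1{2k(\theta-kL_0)},1\big)$ and $a>\max\big(2k(\theta-kL_0)b,\,b\big)$. Then there is a unique Stackelberg equilibrium $(x^*,\sigma(x^*))$, and $\|x_t-x^*\|\to0$ and, for every $i$, $\|y_{i,t}-\sigma(x^*)\|\to0$ as $t\to\infty$, all with rate $\mathcal O\big(\sqrt{\ln t/t}\big)$. -/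

import Mathlib

open Filter Topology Asymptotics
open scoped Matrix.Norms.Frobenius

noncomputable section

namespace SOGD

/-- `ℝ^m` with its Euclidean norm. -/
abbrev E (m : ℕ) := EuclideanSpace ℝ (Fin m)

variable {n m₁ m₂ : ℕ}

/-! ### Partial derivatives of a bifunction `f : ℝ^{m₁} × ℝ^{m₂} → ℝ` -/

/-- `∇₁ f (x, y)`. -/
def grad1 (f : E m₁ → E m₂ → ℝ) (x : E m₁) (y : E m₂) : E m₁ :=
  gradient (fun u => f u y) x

/-- `∇₂ f (x, y)`. -/
def grad2 (f : E m₁ → E m₂ → ℝ) (x : E m₁) (y : E m₂) : E m₂ :=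
  gradient (f x) y

/-- `∇₂₂ f (x, y)`, the Hessian matrix in the second argument. -/
def hess22 (f : E m₁ → E m₂ → ℝ) (x : E m₁) (y : E m₂) : Matrix (Fin m₂) (Fin m₂) ℝ :=
  Matrix.of fun p q => fderiv ℝ (fun w => grad2 f x w) y (EuclideanSpace.single q 1) p

/-- `∇₂₁ f (x, y)`, the derivative of `∇₂ f` in the first argument, as the `m₁ × m₂` matrix with
entries `∂² f / ∂x_p ∂y_q` (so that it maps `ℝ^{m₂}` to `ℝ^{m₁}`). -/
def hess21 (f : E m₁ → E m₂ → ℝ) (x : E m₁) (y : E m₂) : Matrix (Fin m₁) (Fin m₂) ℝ :=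
  Matrix.of fun p q => fderiv ℝ (fun u => grad2 f u y) x (EuclideanSpace.single p 1) q

/-- `f` is `L`-Lipschitz in each of its two arguments on `S × ℝ^{m₂}`. Matrices carry the
Frobenius norm. -/
def LipschitzEach {W : Type*} [NormedAddCommGroup W] (L : ℝ) (S : Set (E m₁))
    (f : E m₁ → E m₂ → W) : Prop :=
  (∀ x ∈ S, ∀ x' ∈ S, ∀ y, ‖f x y - f x' y‖ ≤ L * ‖x - x'‖) ∧
  (∀ x ∈ S, ∀ y y', ‖f x y - f x y'‖ ≤ L * ‖y - y'‖)

/-! ### The game -/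

/-- `y` minimizes the global inner objective `∑ i, g i (x i) ·`. -/
def IsInnerMin (g : Fin n → E m₁ → E m₂ → ℝ) (x : Fin n → E m₁) (y : E m₂) : Prop :=
  ∀ y', ∑ i, g i (x i) y ≤ ∑ i, g i (x i) y'

/-- The aggregation `σ(x) = argmin_y ∑ i, g i (x i) y` (a minimizer, if there is one). -/
def aggr (g : Fin n → E m₁ → E m₂ → ℝ) (x : Fin n → E m₁) : E m₂ :=
  Classical.epsilon (IsInnerMin g x)

/-- The cost `J i (u, σ(u, x_{-i}))` of player `i` as a function of the own action `u`. -/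
def ownCost (J g : Fin n → E m₁ → E m₂ → ℝ) (i : Fin n) (x : Fin n → E m₁) (u : E m₁) : ℝ :=
  J i u (aggr g (Function.update x i u))

/-- Component `i` of the pseudo-gradient `F(x) = col (∇_{x_i} J_i(x_i, σ(x)))`. The gradient is
taken within `Ω i`, since `σ` is defined by the game on `∏ Ω i` only; it is the ordinary gradient
at interior points, and it is always determined along the directions `x_i' - x_i`, `x_i' ∈ Ω i`,
which are the only ones that the monotonicity of `F` on `∏ Ω i` involves. -/
def pseudoGrad (Ω : Fin n → Set (E m₁)) (J g : Fin n → E m₁ → E m₂ → ℝ)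
    (x : Fin n → E m₁) (i : Fin n) : E m₁ :=
  gradientWithin (ownCost J g i x) (Ω i) (x i)

/-- `(x, y)` is a Stackelberg equilibrium. -/
def IsStackelberg (Ω : Fin n → Set (E m₁)) (J g : Fin n → E m₁ → E m₂ → ℝ)
    (x : Fin n → E m₁) (y : E m₂) : Prop :=
  x ∈ Set.univ.pi Ω ∧
  (∀ i, ∀ u ∈ Ω i, J i (x i) (aggr g x) ≤ J i u (aggr g (Function.update x i u))) ∧
  IsInnerMin g x y

/-- Convexity, differentiability and strong convexity built into the definition of the game. -/
structure IsGame (μ : ℝ) (Ω : Fin n → Set (E m₁)) (J g : Fin n → E m₁ → E m₂ → ℝ) : Prop where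
  convex_cost : ∀ i, ∀ x ∈ Set.univ.pi Ω, ConvexOn ℝ (Ω i) (ownCost J g i x)
  diff_J1 : ∀ i, ∀ x ∈ Ω i, ∀ y, DifferentiableAt ℝ (fun u => J i u y) x
  diff_J2 : ∀ i, ∀ x ∈ Ω i, ∀ y, DifferentiableAt ℝ (J i x) y
  strong : ∀ i, ∀ x ∈ Ω i, StrongConvexOn Set.univ μ (g i x)
  diff_g2 : ∀ i, ∀ x ∈ Ω i, ∀ y, DifferentiableAt ℝ (g i x) y
  diff_g22 : ∀ i, ∀ x ∈ Ω i, ∀ y, DifferentiableAt ℝ (fun w => grad2 (g i) x w) y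
  diff_g21 : ∀ i, ∀ x ∈ Ω i, ∀ y, DifferentiableAt ℝ (fun u => grad2 (g i) u y) x

/-- Lipschitz continuity of the first and second order data of the game. -/
structure LipschitzData (L : ℝ) (Ω : Fin n → Set (E m₁)) (J g : Fin n → E m₁ → E m₂ → ℝ) :
    Prop where
  lip_J1 : ∀ i, LipschitzEach L (Ω i) (grad1 (J i))
  lip_J2 : ∀ i, LipschitzEach L (Ω i) (grad2 (J i))
  lip_g2 : ∀ i, LipschitzEach L (Ω i) (grad2 (g i))
  lip_g21 : ∀ i, LipschitzEach L (Ω i) (hess21 (g i))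
  lip_g22 : ∀ i, LipschitzEach L (Ω i) (hess22 (g i))

/-- `F` is `θ`-strongly monotone on `∏ Ω i`. -/
def StronglyMonotone (θ : ℝ) (Ω : Fin n → Set (E m₁))
    (F : (Fin n → E m₁) → Fin n → E m₁) : Prop :=
  ∀ x ∈ Set.univ.pi Ω, ∀ y ∈ Set.univ.pi Ω,
    θ * ∑ i, ‖x i - y i‖ ^ 2 ≤ ∑ i, inner ℝ (F x i - F y i) (x i - y i)

/-- The Lipschitz constant
`L₀ = n L (K₁ (K₃ + μ + K₃ ℓ + μ ℓ) + (K₃ μ + μ²) (1 + ℓ)) / μ²`, `ℓ = K₃ / (√n μ)`,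
of the pseudo-gradient. -/
def lipConst (n : ℕ) (L μ K₁ K₃ : ℝ) : ℝ :=
  let l : ℝ := K₃ / (√(n : ℝ) * μ)
  n * L * (K₁ * (K₃ + μ + K₃ * l + μ * l) + (K₃ * μ + μ ^ 2) * (1 + l)) / μ ^ 2

/-! ### The communication network -/

/-- The graph of a weight matrix: distinct `i`, `j` are adjacent iff their weight is nonzero. -/
def weightGraph (A : Matrix (Fin n) (Fin n) ℝ) : SimpleGraph (Fin n) :=
  SimpleGraph.fromRel fun i j => A i j ≠ 0

/-- Symmetric nonnegative weights with row sums `1`, connected, and without the eigenvalue `-1`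
(so that all eigenvalues other than the simple eigenvalue `1` have modulus less than `1`). -/
structure IsNetwork (A : Matrix (Fin n) (Fin n) ℝ) : Prop where
  symm : A.IsSymm
  nonneg : ∀ i j, 0 ≤ A i j
  row_sum : ∀ i, ∑ j, A i j = 1
  connected : (weightGraph A).Connected
  neg_one : (-1 : ℝ) ∉ spectrum ℝ A

/-! ### The algorithm -/

/-- `P_S[x]`, a point of `S` nearest to `x`. -/
def proj {m : ℕ} (S : Set (E m)) (x : E m) : E m :=
  Classical.epsilon fun p => p ∈ S ∧ ∀ q ∈ S, ‖p - x‖ ≤ ‖q - x‖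

/-- The sequences `x, y, lam, v, z` (time first, then player) are a run of the second order
gradient-based distributed algorithm with weights `A`, step-sizes `κ`, `α`, `k` and `η t`. -/
structure IsRun (Ω : Fin n → Set (E m₁)) (J g : Fin n → E m₁ → E m₂ → ℝ)
    (A : Matrix (Fin n) (Fin n) ℝ) (κ α k : ℝ) (η : ℕ → ℝ)
    (x : ℕ → Fin n → E m₁) (y lam : ℕ → Fin n → E m₂)
    (v : ℕ → Fin n → Matrix (Fin m₂) (Fin m₂) ℝ) (z : ℕ → Fin n → E m₂) : Prop where
  x_zero : ∀ i, x 0 i ∈ Ω i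
  lam_zero : ∀ i, lam 0 i = 0
  v_zero : ∀ i, v 0 i = hess22 (g i) (x 0 i) (y 0 i)
  y_succ : ∀ t i, y (t + 1) i =
    y t i + κ • (∑ j, A i j • lam t j - lam t i - grad2 (g i) (x t i) (y t i))
  lam_succ : ∀ t i, lam (t + 1) i =
    lam t i - κ • (∑ j, A i j • y (t + 1) j - y (t + 1) i)
  v_succ : ∀ t i, v (t + 1) i =
    ∑ j, A i j • v t j + hess22 (g i) (x (t + 1) i) (y (t + 1) i)
      - hess22 (g i) (x t i) (y t i)
  z_succ : ∀ t i, z (t + 1) i =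
    z t i - α • ((n : ℝ) • (v t i).toEuclideanLin (z t i) + grad2 (J i) (x t i) (y t i))
  x_succ : ∀ t i, x (t + 1) i =
    (1 - η t) • x t i + η t • proj (Ω i) (x t i - k •
      (grad1 (J i) (x t i) (y t i) + (hess21 (g i) (x t i) (y t i)).toEuclideanLin (z t i)))

end SOGD

end

/-!
Why the theorem holds.

*Equilibria.* Fix the actions `x`. The inner objective is strongly convex, so `σ(x)` is the zero of
its gradient and is Lipschitz in `x`. Linearizing the optimality condition in the action of player
`i` gives the derivative of `u ↦ J_i (u, σ(u, x_{-i}))` within `Ω i`, in the adjoint form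
`∇₁ J_i + ∇₂₁ g_i z_i` with `H z_i = -∇₂ J_i` and `H = ∑ ∇₂₂ g_j` symmetric and coercive
(`IsGame.hasFDerivWithinAt_ownCost`). Since the costs are convex, Stackelberg equilibria are the
solutions of the variational inequality of this map on `∏ Ω i`
(`IsGame.isStackelberg_iff_isVISol`), and strong monotonicity gives existence and uniqueness.

*Inner loops.* As `η_t` decays subgeometrically, any quantity that contracts geometrically up to an
error of order `η_t` is itself of order `η_t` (`isBigO_of_contraction`). This applies in turn to the
primal-dual pair `(y, λ)`, whose distance to the saddle point for the current actions contracts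
(`primalDual_step`, `IsRun.y_tracking`), to the consensus error of the Hessian trackers `v`
(`IsNetwork.tracking_isBigO`), and to the distance of `z_i` to the adjoint state
(`IsRun.z_tracking`). Hence the players use the pseudo-gradient up to an error of order `η_t`.

*Outer loop.* The actions follow the relaxed projection method
`x ↦ x + η_t (P[x - k F(x)] - x)` with errors of order `η_t`. The Lyapunov function is not the
distance to the equilibrium but the regularized gap function
`G(x) = max_q ⟪F x, x - q⟫ - ‖x - q‖² / (2k)`: for a strongly monotone Lipschitz map `F` and every
`k > 0` it satisfies `G(x_{t+1}) ≤ (1 - ω η_t) G(x_t) + O(η_t²)` with `ω = min 1 (2kθ)`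
(`regGap_step`), and it dominates a multiple of `‖x - x*‖²` (`norm_sq_le_regGap`). The conditions on
`b` ensure `ω b ≥ 1`, so that `G(x_t) = O(log t / t)` (`isBigO_log_div_of_recursion`).
-/

namespace SOGD

/-! ### Real sequences driven by vanishing step sizes -/

/-- A geometric contraction perturbed at the scale `η` settles at the scale `η`, if `η` decays
subgeometrically. -/
theorem isBigO_of_contraction {u w η : ℕ → ℝ} {ρ : ℝ} (hρ : ρ < 1)
    (hη : ∀ t, 0 < η t) (hlim : Tendsto (fun t => η (t + 1) / η t) atTop (𝓝 1))
    (hu : ∀ t, 0 ≤ u t) (hw : w =O[atTop] η)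
    (hrec : ∀ᶠ t in atTop, u (t + 1) ≤ ρ * u t + w t) (hρ0 : 0 ≤ ρ) : u =O[atTop] η := by
  obtain ⟨C, hC0, hC⟩ := hw.exists_pos
  have h1 : ∀ᶠ t in atTop, (1 + ρ) / 2 < η (t + 1) / η t :=
    hlim.eventually (lt_mem_nhds (by linarith))
  obtain ⟨T, hT⟩ := eventually_atTop.1 (h1.and (hC.bound.and hrec))
  set M := max (u T / η T) (2 * C / (1 - ρ)) with hM
  have hM1 : u T / η T ≤ M := le_max_left _ _
  have hM2 : 2 * C ≤ M * (1 - ρ) := by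
    have : 2 * C / (1 - ρ) ≤ M := le_max_right _ _
    rwa [div_le_iff₀ (by linarith)] at this
  have hM0 : 0 ≤ M := le_trans (div_nonneg (hu T) (hη T).le) hM1
  have key : ∀ t, T ≤ t → u t ≤ M * η t := by
    intro t ht
    induction t, ht using Nat.le_induction with
    | base => rwa [div_le_iff₀ (hη T)] at hM1
    | succ t ht ih =>
      obtain ⟨ha, hb, hc⟩ := hT t ht
      rw [lt_div_iff₀ (hη t)] at ha
      have hw' : w t ≤ C * η t := by
        have := le_of_abs_le hb
        rwa [Real.norm_of_nonneg (hη t).le] at this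
      have e1 : ρ * u t ≤ ρ * (M * η t) := mul_le_mul_of_nonneg_left ih hρ0
      have e2 : M * ((1 + ρ) / 2 * η t) ≤ M * η (t + 1) := mul_le_mul_of_nonneg_left ha.le hM0
      have e3 : 2 * C * η t ≤ M * (1 - ρ) * η t := mul_le_mul_of_nonneg_right hM2 (hη t).le
      nlinarith
  refine IsBigO.of_bound M (eventually_atTop.2 ⟨T, fun t ht => ?_⟩)
  rw [Real.norm_of_nonneg (hu t), Real.norm_of_nonneg (hη t).le]
  exact key t ht

/-- The Robbins–Monro type recursion behind the rate `log t / t`: multiplied by `t + a - 1`, it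
says that `(t + a - 1) G t` grows no faster than the harmonic sums. -/
theorem isBigO_log_div_of_recursion {G : ℕ → ℝ} {a C : ℝ} (ha : 1 < a) (hG : ∀ t, 0 ≤ G t)
    (hC : 0 ≤ C)
    (hrec : ∀ᶠ t : ℕ in atTop, G (t + 1) ≤ (1 - 1 / (t + a)) * G t + C * (1 / (t + a)) ^ 2) :
    G =O[atTop] fun t : ℕ => Real.log t / t := by
  obtain ⟨T, hT⟩ := eventually_atTop.1 hrec
  set M := |(T + a - 1) * G T - C * Real.log (T + a - 1)| with hM
  have key : ∀ t : ℕ, T ≤ t → (t + a - 1) * G t ≤ M + C * Real.log (t + a - 1) := by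
    intro t ht
    induction t, ht using Nat.le_induction with
    | base => linarith [le_abs_self ((T + a - 1) * G T - C * Real.log (T + a - 1))]
    | succ t ht ih =>
      have ht0 : (0 : ℝ) ≤ t := t.cast_nonneg
      have hs : 0 < (t : ℝ) + a := by linarith
      have h1 := hT t ht
      have h2 : ((t : ℝ) + a) * G (t + 1) ≤ (t + a - 1) * G t + C * (1 / (t + a)) := by
        have := mul_le_mul_of_nonneg_left h1 hs.le
        refine this.trans (le_of_eq ?_)
        field_simp
      -- `log s - log (s - 1) ≥ 1 / s`
      have h3 : 1 / ((t : ℝ) + a) ≤ Real.log (t + a) - Real.log (t + a - 1) := by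
        have h4 := Real.log_le_sub_one_of_pos (x := ((t : ℝ) + a - 1) / (t + a))
          (div_pos (by linarith) hs)
        rw [Real.log_div (by linarith) hs.ne'] at h4
        have : ((t : ℝ) + a - 1) / (t + a) - 1 = - (1 / (t + a)) := by field_simp; ring
        linarith
      have h5 := mul_le_mul_of_nonneg_left h3 hC
      push_cast
      rw [show (t : ℝ) + 1 + a - 1 = t + a by ring]
      linarith
  obtain ⟨N, hN⟩ := exists_nat_ge a
  refine IsBigO.of_bound (2 * M + 2 * C) (eventually_atTop.2 ⟨max T (max N 2), fun t ht => ?_⟩)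
  have htT : T ≤ t := le_trans (le_max_left _ _) ht
  have htN : N ≤ t := le_trans (le_trans (le_max_left _ _) (le_max_right _ _)) ht
  have ht2 : 2 ≤ t := le_trans (le_trans (le_max_right _ _) (le_max_right _ _)) ht
  have ht2' : (2 : ℝ) ≤ t := by exact_mod_cast ht2
  have htN' : a ≤ t := hN.trans (by exact_mod_cast htN)
  have hlog2 : 1 / 2 ≤ Real.log t := by
    have := Real.log_le_log (by norm_num) ht2'
    linarith [Real.log_two_gt_d9]
  have hlog : Real.log (t + a - 1) ≤ 2 * Real.log t := by
    rw [show 2 * Real.log (t : ℝ) = Real.log ((t : ℝ) ^ 2) by rw [Real.log_pow]; norm_num]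
    exact Real.log_le_log (by linarith) (by nlinarith)
  have hk := key t htT
  have hM0 : 0 ≤ M := abs_nonneg _
  rw [Real.norm_of_nonneg (hG t), Real.norm_of_nonneg (by positivity), ← mul_div_assoc,
    le_div_iff₀ (by linarith)]
  have e1 : G t * t ≤ (t + a - 1) * G t := by nlinarith [hG t]
  have e2 := mul_le_mul_of_nonneg_left hlog hC
  nlinarith

theorem step_pos {a b : ℝ} (hb : 1 ≤ b) (hab : b < a) (t : ℕ) : 0 < b / ((t : ℝ) + a) := by
  have : (0 : ℝ) ≤ t := t.cast_nonneg
  exact div_pos (by linarith) (by linarith)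

theorem step_lt_one {a b : ℝ} (hb : 1 ≤ b) (hab : b < a) (t : ℕ) : b / ((t : ℝ) + a) < 1 := by
  have : (0 : ℝ) ≤ t := t.cast_nonneg
  rw [div_lt_one (by linarith)]; linarith

theorem tendsto_step (a b : ℝ) : Tendsto (fun t : ℕ => b / ((t : ℝ) + a)) atTop (𝓝 0) :=
  tendsto_const_nhds.div_atTop (tendsto_atTop_add_const_right _ _ tendsto_natCast_atTop_atTop)

theorem tendsto_step_ratio {a b : ℝ} (hb : 1 ≤ b) (hab : b < a) :
    Tendsto (fun t : ℕ => (b / (((t + 1 : ℕ) : ℝ) + a)) / (b / ((t : ℝ) + a))) atTop (𝓝 1) := by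
  have h : Tendsto (fun t : ℕ => 1 - 1 / (((t + 1 : ℕ) : ℝ) + a)) atTop (𝓝 (1 - 0)) :=
    tendsto_const_nhds.sub ((tendsto_step a 1).comp (tendsto_add_atTop_nat 1))
  rw [sub_zero] at h
  refine h.congr fun t => ?_
  have : (0 : ℝ) ≤ t := t.cast_nonneg
  have h1 : (t : ℝ) + a ≠ 0 := by linarith
  have h2 : (t : ℝ) + 1 + a ≠ 0 := by linarith
  have h3 : b ≠ 0 := by linarith
  push_cast
  field_simp
  ring

theorem tendsto_log_div_nat : Tendsto (fun t : ℕ => Real.log t / t) atTop (𝓝 0) := by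
  have h := (Real.isLittleO_log_id_atTop.tendsto_div_nhds_zero).comp tendsto_natCast_atTop_atTop
  exact h

/-- A sequence of order `b / (t + a)` is of order `√(log t / t)`. -/
theorem step_isBigO_sqrt {a b : ℝ} (hb : 1 ≤ b) (hab : b < a) :
    (fun t : ℕ => b / ((t : ℝ) + a)) =O[atTop] fun t : ℕ => √(Real.log t / t) := by
  refine IsBigO.of_bound (2 * b) (eventually_atTop.2 ⟨2, fun t ht => ?_⟩)
  have ht2' : (2 : ℝ) ≤ t := by exact_mod_cast ht
  have hlog2 : 1 / 2 ≤ Real.log t := by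
    have := Real.log_le_log (by norm_num) ht2'
    linarith [Real.log_two_gt_d9]
  rw [Real.norm_of_nonneg (step_pos hb hab t).le, Real.norm_of_nonneg (Real.sqrt_nonneg _)]
  have h1 : b / ((t : ℝ) + a) ≤ b * (1 / t) := by
    rw [mul_one_div]
    exact div_le_div_of_nonneg_left (by linarith) (by linarith) (by linarith)
  have h2 : 1 / (t : ℝ) ≤ 2 * √(Real.log t / t) := by
    rw [show 1 / (t : ℝ) = 2 * (1 / (2 * t)) by field_simp]
    refine mul_le_mul_of_nonneg_left (Real.le_sqrt_of_sq_le ?_) (by norm_num)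
    rw [div_pow, div_le_div_iff₀ (by positivity) (by positivity)]
    nlinarith
  calc _ ≤ b * (1 / t) := h1
    _ ≤ b * (2 * √(Real.log t / t)) := mul_le_mul_of_nonneg_left h2 (by linarith)
    _ = _ := by ring

/-! ### Strongly monotone variational inequalities and the regularized gap function -/

section Gap

variable {X : Type*} [NormedAddCommGroup X] [InnerProductSpace ℝ X]

/-- `P` is the metric projection onto the convex set `S`, in its variational characterization. -/
def IsConvexProj (S : Set X) (P : X → X) : Prop :=
  ∀ w, P w ∈ S ∧ ∀ q ∈ S, inner ℝ (w - P w) (q - P w) ≤ 0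

theorem IsConvexProj.norm_sub_le {S : Set X} {P : X → X} (hP : IsConvexProj S P) (w w' : X) :
    ‖P w - P w'‖ ≤ ‖w - w'‖ := by
  have h1 := (hP w).2 _ (hP w').1
  have h2 := (hP w').2 _ (hP w).1
  have h3 : ‖P w - P w'‖ ^ 2 ≤ inner ℝ (w - w') (P w - P w') := by
    rw [← real_inner_self_eq_norm_sq]
    have : inner ℝ (w - w') (P w - P w') - inner ℝ (P w - P w') (P w - P w') =
        - inner ℝ (w - P w) (P w' - P w) - inner ℝ (w' - P w') (P w - P w') := by
      rw [← neg_sub (P w) (P w'), inner_neg_right]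
      simp only [inner_sub_left]
      ring
    linarith
  have h4 := real_inner_le_norm (w - w') (P w - P w')
  by_contra hlt
  push Not at hlt
  have : 0 ≤ ‖w - w'‖ := norm_nonneg _
  nlinarith

/-- `x` solves the variational inequality `⟪F x, q - x⟫ ≥ 0`, `q ∈ S`. -/
def IsVISol (S : Set X) (F : X → X) (x : X) : Prop :=
  x ∈ S ∧ ∀ q ∈ S, 0 ≤ inner ℝ (F x) (q - x)

theorem IsVISol.unique {S : Set X} {F : X → X} {θ : ℝ} (hθ : 0 < θ)
    (hmono : ∀ x ∈ S, ∀ y ∈ S, θ * ‖x - y‖ ^ 2 ≤ inner ℝ (F x - F y) (x - y))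
    {x y : X} (hx : IsVISol S F x) (hy : IsVISol S F y) : x = y := by
  have h := hmono x hx.1 y hy.1
  have h1 := hx.2 y hy.1
  have h2 := hy.2 x hx.1
  rw [inner_sub_left] at h
  rw [← neg_sub, inner_neg_right] at h1
  have h3 : ‖x - y‖ ^ 2 ≤ 0 := by nlinarith
  have h4 : ‖x - y‖ = 0 := by nlinarith [norm_nonneg (x - y), sq_nonneg ‖x - y‖]
  exact sub_eq_zero.1 (norm_eq_zero.1 h4)

/-- Existence for a strongly monotone variational inequality: for a small step `s` the map
`x ↦ P (x - s F x)` is a contraction, so a minimizer of its displacement is a fixed point. -/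
theorem exists_isVISol {S : Set X} {P F : X → X} {θ ℒ : ℝ} (hP : IsConvexProj S P) (hθ : 0 < θ)
    (hS : IsCompact S) (hne : S.Nonempty)
    (hlip : ∀ x ∈ S, ∀ y ∈ S, ‖F x - F y‖ ≤ ℒ * ‖x - y‖) (hℒ : 0 < ℒ)
    (hmono : ∀ x ∈ S, ∀ y ∈ S, θ * ‖x - y‖ ^ 2 ≤ inner ℝ (F x - F y) (x - y)) :
    ∃ x, IsVISol S F x := by
  set s := θ / ℒ ^ 2 with hs
  have hs0 : 0 < s := by positivity
  have hsL : s * ℒ ^ 2 = θ := by rw [hs]; field_simp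
  set T : X → X := fun x => P (x - s • F x) with hT
  have hcontr : ∀ x ∈ S, ∀ y ∈ S, ‖T x - T y‖ ^ 2 ≤ (1 - s * θ) * ‖x - y‖ ^ 2 := by
    intro x hx y hy
    have h1 := hP.norm_sub_le (x - s • F x) (y - s • F y)
    have h2 : ‖T x - T y‖ ^ 2 ≤ ‖(x - y) - s • (F x - F y)‖ ^ 2 := by
      refine pow_le_pow_left₀ (norm_nonneg _) (h1.trans (le_of_eq ?_)) 2
      congr 1; rw [smul_sub]; abel
    rw [norm_sub_sq_real (x - y), inner_smul_right, norm_smul, Real.norm_of_nonneg hs0.le,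
      real_inner_comm] at h2
    have h3 := hmono x hx y hy
    have h4 := hlip x hx y hy
    have h5 : ‖F x - F y‖ ^ 2 ≤ (ℒ * ‖x - y‖) ^ 2 := pow_le_pow_left₀ (norm_nonneg _) h4 2
    have h6 : s ^ 2 * ‖F x - F y‖ ^ 2 ≤ s ^ 2 * (ℒ * ‖x - y‖) ^ 2 := by gcongr
    have h7 : s ^ 2 * (ℒ * ‖x - y‖) ^ 2 = s * θ * ‖x - y‖ ^ 2 := by rw [← hsL]; ring
    have h8 := mul_le_mul_of_nonneg_left h3 hs0.le
    rw [mul_pow] at h2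
    nlinarith
  have hcF : ContinuousOn F S := by
    refine LipschitzOnWith.continuousOn (K := ⟨ℒ, hℒ.le⟩) (LipschitzOnWith.of_dist_le_mul ?_)
    intro x hx y hy
    rw [dist_eq_norm, dist_eq_norm]; exact hlip x hx y hy
  have hcP : Continuous P := by
    refine LipschitzWith.continuous (K := 1) (LipschitzWith.of_dist_le_mul ?_)
    intro x y
    rw [dist_eq_norm, dist_eq_norm, NNReal.coe_one, one_mul]; exact hP.norm_sub_le x y
  have hcT : ContinuousOn (fun x => ‖x - T x‖) S :=
    (continuousOn_id.sub (hcP.comp_continuousOn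
      (continuousOn_id.sub (hcF.const_smul s)))).norm
  obtain ⟨x, hx, hmin⟩ := hS.exists_isMinOn hne hcT
  have hTx : T x ∈ S := (hP _).1
  have h1 : ‖x - T x‖ ≤ ‖T x - T (T x)‖ := hmin hTx
  have h2 := hcontr x hx (T x) hTx
  have h3 : ‖x - T x‖ ^ 2 ≤ ‖T x - T (T x)‖ ^ 2 := pow_le_pow_left₀ (norm_nonneg _) h1 2
  have h4 : s * θ * ‖x - T x‖ ^ 2 ≤ 0 := by nlinarith
  have h5 : ‖x - T x‖ ^ 2 ≤ 0 := by
    by_contra hc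
    push Not at hc
    have := mul_pos (mul_pos hs0 hθ) hc
    linarith
  have h6 : x = T x := by
    have : ‖x - T x‖ = 0 := by nlinarith [norm_nonneg (x - T x), sq_nonneg ‖x - T x‖]
    exact sub_eq_zero.1 (norm_eq_zero.1 this)
  refine ⟨x, hx, fun q hq => ?_⟩
  have h7 := (hP (x - s • F x)).2 q hq
  rw [show P (x - s • F x) = x from h6.symm, sub_sub_cancel_left, inner_neg_left,
    real_inner_smul_left] at h7
  by_contra hc
  push Not at hc
  nlinarith

/-- The regularized gap function `max_{q ∈ S} ⟪F x, x - q⟫ - ‖x - q‖² / (2k)` of the variational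
inequality; the maximum is attained at `q = P (x - k F x)`. -/
noncomputable def regGap (P F : X → X) (k : ℝ) (x : X) : ℝ :=
  inner ℝ (F x) (x - P (x - k • F x)) - ‖x - P (x - k • F x)‖ ^ 2 / (2 * k)

theorem le_regGap {S : Set X} {P F : X → X} {k : ℝ} (hP : IsConvexProj S P) (hk : 0 < k)
    (x : X) {q : X} (hq : q ∈ S) :
    inner ℝ (F x) (x - q) - ‖x - q‖ ^ 2 / (2 * k) ≤ regGap P F k x := by
  unfold regGap
  have h := (hP (x - k • F x)).2 q hq
  set p := P (x - k • F x)
  have e1 : x - q = (x - p) - (q - p) := by abel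
  have e2 : x - k • F x - p = (x - p) - k • F x := by abel
  rw [e2, inner_sub_left, real_inner_smul_left] at h
  rw [e1, inner_sub_right, norm_sub_sq_real]
  have h2 : inner ℝ (x - p) (q - p) / k ≤ inner ℝ (F x) (q - p) := by
    rw [div_le_iff₀ hk]; linarith
  have h3 : 0 ≤ ‖q - p‖ ^ 2 / (2 * k) := by positivity
  have h4 : (‖x - p‖ ^ 2 - 2 * inner ℝ (x - p) (q - p) + ‖q - p‖ ^ 2) / (2 * k) =
    ‖x - p‖ ^ 2 / (2 * k) - inner ℝ (x - p) (q - p) / k + ‖q - p‖ ^ 2 / (2 * k) := by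
    field_simp
  rw [h4]
  linarith

theorem norm_sq_div_le_inner {S : Set X} {P F : X → X} {k : ℝ} (hP : IsConvexProj S P)
    (hk : 0 < k) {x : X} (hx : x ∈ S) :
    ‖x - P (x - k • F x)‖ ^ 2 / k ≤ inner ℝ (F x) (x - P (x - k • F x)) := by
  have h := (hP (x - k • F x)).2 x hx
  set p := P (x - k • F x)
  rw [show x - k • F x - p = (x - p) - k • F x by abel, inner_sub_left, real_inner_smul_left,
    real_inner_self_eq_norm_sq] at h
  rw [div_le_iff₀ hk]; linarith

/-- For a strongly monotone map the regularized gap dominates the squared distance to the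
solution; test the maximum with points of the segment towards the solution. -/
theorem norm_sq_le_regGap {S : Set X} {P F : X → X} {k θ : ℝ} (hP : IsConvexProj S P)
    (hk : 0 < k) (hθ : 0 < θ) (hS : Convex ℝ S)
    (hmono : ∀ x ∈ S, ∀ y ∈ S, θ * ‖x - y‖ ^ 2 ≤ inner ℝ (F x - F y) (x - y))
    {xs : X} (hxs : IsVISol S F xs) {x : X} (hx : x ∈ S) :
    min 1 (k * θ) * θ / 2 * ‖x - xs‖ ^ 2 ≤ regGap P F k x := by
  set s := min 1 (k * θ) with hs
  have hs0 : 0 < s := lt_min one_pos (by positivity)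
  have hs1 : s ≤ 1 := min_le_left _ _
  have hs2 : s ≤ k * θ := min_le_right _ _
  have hq : x + s • (xs - x) ∈ S := hS.add_smul_sub_mem hx hxs.1 ⟨hs0.le, hs1⟩
  have h := le_regGap (F := F) hP hk x hq
  rw [show x - (x + s • (xs - x)) = s • (x - xs) by rw [← neg_sub x xs]; module,
    inner_smul_right, norm_smul, Real.norm_of_nonneg hs0.le, mul_pow] at h
  have h1 := hmono x hx xs hxs.1
  have h2 := hxs.2 x hx
  rw [inner_sub_left] at h1
  have h3 : s ^ 2 * ‖x - xs‖ ^ 2 / (2 * k) ≤ s * θ / 2 * ‖x - xs‖ ^ 2 := by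
    rw [div_le_iff₀ (by positivity)]
    have : s * s ≤ s * (k * θ) := mul_le_mul_of_nonneg_left hs2 hs0.le
    nlinarith [sq_nonneg ‖x - xs‖]
  have h4 : s * (θ * ‖x - xs‖ ^ 2) ≤ s * inner ℝ (F x) (x - xs) :=
    mul_le_mul_of_nonneg_left (by linarith) hs0.le
  nlinarith

/-- One relaxed projection step, carried out with an error `δ`, decreases the regularized gap by
the factor `1 - ω η`, `ω ≤ min 1 (2kθ)`, up to second order terms. No smallness of `k` is needed:
the cross term `⟪F x⁺ - F x, x - p⟫` is, up to the error, `-⟪F x⁺ - F x, x⁺ - x⟫ / η`, which strong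
monotonicity controls. -/
theorem regGap_step {S : Set X} {P F : X → X} {k θ ℒ M D ω : ℝ} (hP : IsConvexProj S P)
    (hk : 0 < k) (hθ : 0 < θ) (hℒ : 0 ≤ ℒ) (hD : 0 ≤ D)
    (hω1 : ω ≤ 1) (hω2 : ω ≤ 2 * k * θ)
    (hlip : ∀ x ∈ S, ∀ y ∈ S, ‖F x - F y‖ ≤ ℒ * ‖x - y‖)
    (hM : ∀ x ∈ S, ‖F x‖ ≤ M) (hdiam : ∀ x ∈ S, ∀ y ∈ S, ‖x - y‖ ≤ D)
    (hmono : ∀ x ∈ S, ∀ y ∈ S, θ * ‖x - y‖ ^ 2 ≤ inner ℝ (F x - F y) (x - y))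
    {x x' p' : X} {η δ : ℝ} (hx : x ∈ S) (hx' : x' ∈ S) (hp' : p' ∈ S) (hη : 0 < η)
    (hδ : ‖p' - P (x - k • F x)‖ ≤ δ) (hstep : x' = x + η • (p' - x)) :
    regGap P F k x' ≤ (1 - ω * η) * regGap P F k x +
      ((ℒ + ℒ * (1 + k * ℒ) + (1 + k * ℒ) / k) * D ^ 2 * η ^ 2
        + (M + ℒ * D + D / k + 2 * θ * D) * (η * δ)) := by
  have hq := (hP (x' - k • F x')).1
  have hpS := (hP (x - k • F x)).1
  have hlow := le_regGap (F := F) hP hk x hq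
  have hr := norm_sq_div_le_inner (F := F) hP hk hx
  have hpp : ‖P (x - k • F x) - P (x' - k • F x')‖ ≤ (1 + k * ℒ) * ‖x' - x‖ := by
    refine (hP.norm_sub_le _ _).trans ?_
    have h1 := hlip x' hx' x hx
    calc ‖x - k • F x - (x' - k • F x')‖ = ‖k • (F x' - F x) - (x' - x)‖ := by
          congr 1; rw [smul_sub]; abel
      _ ≤ ‖k • (F x' - F x)‖ + ‖x' - x‖ := norm_sub_le _ _
      _ ≤ k * (ℒ * ‖x' - x‖) + ‖x' - x‖ := by
          rw [norm_smul, Real.norm_of_nonneg hk.le]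
          gcongr
      _ = _ := by ring
  unfold regGap at hlow ⊢
  set p := P (x - k • F x) with hp
  set q := P (x' - k • F x') with hqdef
  set d := x' - x with hd
  set r := x - p with hrdef
  set w := F x' - F x with hw
  set ε := p' - p with hε
  have hδ0 : 0 ≤ δ := (norm_nonneg _).trans hδ
  have hdr : d = η • (ε - r) := by
    rw [hd, hstep, hε, hrdef]; simp
  have hdD : ‖d‖ ≤ η * D := by
    have : d = η • (p' - x) := by rw [hd, hstep]; abel
    rw [this, norm_smul, Real.norm_of_nonneg hη.le]
    exact mul_le_mul_of_nonneg_left (hdiam _ hp' _ hx) hη.le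
  have hrD : ‖r‖ ≤ D := hdiam _ hx _ hpS
  have hdsq : ‖d‖ ^ 2 ≤ D ^ 2 * η ^ 2 := by
    rw [← mul_pow, mul_comm D]; exact pow_le_pow_left₀ (norm_nonneg _) hdD 2
  have hwn : ‖w‖ ≤ ℒ * ‖d‖ := hlip x' hx' x hx
  have hwd : inner ℝ w d ≤ ℒ * ‖d‖ ^ 2 := by
    have := real_inner_le_norm w d
    nlinarith [norm_nonneg d]
  have hwd2 : θ * ‖d‖ ^ 2 ≤ inner ℝ w d := hmono x' hx' x hx
  have e1 : x - q = r + (p - q) := by rw [hrdef]; abel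
  have e2 : x' - q = d + (r + (p - q)) := by rw [hrdef, hd]; abel
  have e3 : F x' = F x + w := by rw [hw]; abel
  rw [e1] at hlow
  rw [e2, e3]
  clear_value d r w ε
  -- expansion of the difference of the two test values
  have hFd : inner ℝ (F x) d ≤ - η * inner ℝ (F x) r + η * (M * δ) := by
    rw [hdr, inner_smul_right, inner_sub_right]
    have h1 : inner ℝ (F x) ε ≤ M * δ :=
      (real_inner_le_norm _ _).trans (mul_le_mul (hM x hx) hδ (norm_nonneg _)
        ((norm_nonneg _).trans (hM x hx)))
    have := mul_le_mul_of_nonneg_left h1 hη.le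
    linarith
  have hwr : inner ℝ w r ≤ ℒ * D * (η * δ) - θ * η * ‖r‖ ^ 2 + 2 * θ * D * (η * δ) := by
    have h1 : η * inner ℝ w r = η * inner ℝ w ε - inner ℝ w d := by
      rw [hdr, inner_smul_right, inner_sub_right]; ring
    have h2 : inner ℝ w ε ≤ ℒ * (η * D) * δ :=
      (real_inner_le_norm _ _).trans (mul_le_mul
        (hwn.trans (mul_le_mul_of_nonneg_left hdD hℒ)) hδ (norm_nonneg _) (by positivity))
    have h3 : η ^ 2 * (‖r‖ ^ 2 - 2 * (D * δ)) ≤ ‖d‖ ^ 2 := by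
      rw [hdr, norm_smul, Real.norm_of_nonneg hη.le, mul_pow, norm_sub_sq_real]
      have h4 : inner ℝ ε r ≤ δ * D :=
        (real_inner_le_norm _ _).trans (mul_le_mul hδ hrD (norm_nonneg _) hδ0)
      refine mul_le_mul_of_nonneg_left ?_ (by positivity)
      nlinarith [sq_nonneg ‖ε‖]
    have h5 : η * inner ℝ w r ≤
        η * (ℒ * D * (η * δ) - θ * η * ‖r‖ ^ 2 + 2 * θ * D * (η * δ)) := by
      have h6 := mul_le_mul_of_nonneg_left h3 hθ.le
      have h7 := mul_le_mul_of_nonneg_left h2 hη.le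
      nlinarith
    exact le_of_mul_le_mul_left h5 hη
  have hwpq : inner ℝ w (p - q) ≤ ℒ * (1 + k * ℒ) * ‖d‖ ^ 2 := by
    refine (real_inner_le_norm _ _).trans ((mul_le_mul hwn hpp (norm_nonneg _)
      (by positivity)).trans (le_of_eq (by ring)))
  have hdrk : - inner ℝ d r ≤ η * ‖r‖ ^ 2 + η * (δ * D) := by
    rw [hdr, real_inner_smul_left, inner_sub_left, real_inner_self_eq_norm_sq]
    have h4 : - inner ℝ ε r ≤ δ * D := by
      rw [← inner_neg_left]
      refine (real_inner_le_norm _ _).trans ?_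
      rw [norm_neg]
      exact mul_le_mul hδ hrD (norm_nonneg _) hδ0
    have := mul_le_mul_of_nonneg_left h4 hη.le
    linarith
  have hdpq : - inner ℝ d (p - q) ≤ (1 + k * ℒ) * ‖d‖ ^ 2 := by
    rw [← inner_neg_left]
    refine (real_inner_le_norm _ _).trans ?_
    rw [norm_neg]
    refine (mul_le_mul_of_nonneg_left hpp (norm_nonneg _)).trans (le_of_eq (by ring))
  have e4 : inner ℝ (F x + w) (d + (r + (p - q))) = inner ℝ (F x) (r + (p - q)) +
      inner ℝ (F x) d + inner ℝ w d + inner ℝ w r + inner ℝ w (p - q) := by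
    simp only [inner_add_left, inner_add_right]; ring
  have e5 : ‖d + (r + (p - q))‖ ^ 2 / (2 * k) = ‖r + (p - q)‖ ^ 2 / (2 * k)
      + inner ℝ d r / k + inner ℝ d (p - q) / k + ‖d‖ ^ 2 / (2 * k) := by
    rw [norm_add_sq_real d, inner_add_right]; field_simp; ring
  rw [e4, e5]
  have f1 : - (inner ℝ d r / k) ≤ η * (‖r‖ ^ 2 / k) + D / k * (η * δ) := by
    have := div_le_div_of_nonneg_right hdrk hk.le
    rw [neg_div] at this
    refine this.trans (le_of_eq ?_)
    field_simp
  have f2 : - (inner ℝ d (p - q) / k) ≤ (1 + k * ℒ) / k * ‖d‖ ^ 2 := by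
    have := div_le_div_of_nonneg_right hdpq hk.le
    rw [neg_div] at this
    refine this.trans (le_of_eq ?_)
    field_simp
  have f3 : 0 ≤ ‖d‖ ^ 2 / (2 * k) := by positivity
  have f4 : (ℒ + ℒ * (1 + k * ℒ) + (1 + k * ℒ) / k) * ‖d‖ ^ 2 ≤
      (ℒ + ℒ * (1 + k * ℒ) + (1 + k * ℒ) / k) * (D ^ 2 * η ^ 2) :=
    mul_le_mul_of_nonneg_left hdsq (by positivity)
  -- the main terms: this is where `ω ≤ 1` and `ω ≤ 2kθ` enter
  have main : - η * inner ℝ (F x) r + η * (‖r‖ ^ 2 / k) - θ * η * ‖r‖ ^ 2 ≤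
      - (ω * η) * (inner ℝ (F x) r - ‖r‖ ^ 2 / (2 * k)) := by
    have g1 : (1 - ω) * (‖r‖ ^ 2 / k) ≤ (1 - ω) * inner ℝ (F x) r :=
      mul_le_mul_of_nonneg_left hr (by linarith)
    have g2 : ‖r‖ ^ 2 / (2 * k) * ω ≤ ‖r‖ ^ 2 / (2 * k) * (2 * k * θ) :=
      mul_le_mul_of_nonneg_left hω2 (by positivity)
    have g3 : ‖r‖ ^ 2 / (2 * k) * (2 * k * θ) = θ * ‖r‖ ^ 2 := by field_simp
    have g4 : ‖r‖ ^ 2 / k = 2 * (‖r‖ ^ 2 / (2 * k)) := by field_simp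
    rw [g4] at g1 ⊢
    rw [g3] at g2
    have g5 := mul_le_mul_of_nonneg_left g1 hη.le
    have g6 := mul_le_mul_of_nonneg_left g2 hη.le
    linear_combination g5 + g6
  linarith

/-- Convergence rate of the relaxed projection method with step sizes `b / (t + a)` and errors of
the same order. -/
theorem isBigO_of_projected_steps {S : Set X} {P F : X → X} {k θ ℒ M D a b : ℝ}
    (hP : IsConvexProj S P) (hk : 0 < k) (hθ : 0 < θ) (hS : Convex ℝ S) (hℒ : 0 ≤ ℒ) (hD : 0 ≤ D)
    (hb : 1 ≤ b) (hbk : 1 ≤ 2 * k * θ * b) (hab : b < a)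
    (hlip : ∀ x ∈ S, ∀ y ∈ S, ‖F x - F y‖ ≤ ℒ * ‖x - y‖)
    (hM : ∀ x ∈ S, ‖F x‖ ≤ M) (hdiam : ∀ x ∈ S, ∀ y ∈ S, ‖x - y‖ ≤ D)
    (hmono : ∀ x ∈ S, ∀ y ∈ S, θ * ‖x - y‖ ^ 2 ≤ inner ℝ (F x - F y) (x - y))
    {xs : X} (hxs : IsVISol S F xs) {x p : ℕ → X} (hx : ∀ t, x t ∈ S) (hp : ∀ t, p t ∈ S)
    (hδ : (fun t => p t - P (x t - k • F (x t))) =O[atTop] fun t : ℕ => b / ((t : ℝ) + a))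
    (hstep : ∀ t : ℕ, x (t + 1) = x t + (b / ((t : ℝ) + a)) • (p t - x t)) :
    (fun t => ‖x t - xs‖ ^ 2) =O[atTop] fun t : ℕ => Real.log t / t := by
  obtain ⟨c, hc0, hc⟩ := hδ.exists_pos
  have hM0 : 0 ≤ M := (norm_nonneg _).trans (hM _ hxs.1)
  set c' := min 1 (k * θ) * θ / 2 with hc'
  have hc'0 : 0 < c' := by
    have : 0 < min 1 (k * θ) := lt_min one_pos (by positivity)
    positivity
  have hlow : ∀ t, c' * ‖x t - xs‖ ^ 2 ≤ regGap P F k (x t) := fun t =>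
    norm_sq_le_regGap hP hk hθ hS hmono hxs (hx t)
  set C := (ℒ + ℒ * (1 + k * ℒ) + (1 + k * ℒ) / k) * D ^ 2 + (M + ℒ * D + D / k + 2 * θ * D) * c
    with hC
  have hgap : (fun t => regGap P F k (x t)) =O[atTop] fun t : ℕ => Real.log t / t := by
    refine isBigO_log_div_of_recursion (a := a) (C := C * b ^ 2) (by linarith)
      (fun t => le_trans (by positivity) (hlow t)) (by positivity) ?_
    filter_upwards [hc.bound] with t ht
    have hη := step_pos hb hab t
    set η := b / ((t : ℝ) + a) with hηdef
    rw [Real.norm_of_nonneg hη.le] at ht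
    have hω2 : 1 / b ≤ 2 * k * θ := by rw [div_le_iff₀ (by linarith)]; exact hbk
    have hω1 : 1 / b ≤ 1 := by rw [div_le_iff₀ (by linarith)]; linarith
    have h := regGap_step hP hk hθ hℒ hD hω1 hω2 hlip hM hdiam hmono (hx t) (hx (t + 1)) (hp t)
      hη ht (hstep t)
    have e1 : 1 / b * η = 1 / (t + a) := by rw [hηdef]; field_simp
    have e2 : b ^ 2 * (1 / (t + a)) ^ 2 = η ^ 2 := by rw [hηdef, ← mul_pow, mul_one_div]
    rw [e1] at h
    rw [mul_assoc, e2]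
    refine h.trans (le_of_eq ?_)
    rw [hC]; ring
  refine (IsBigO.of_bound c'⁻¹ (Eventually.of_forall fun t => ?_)).trans hgap
  rw [Real.norm_of_nonneg (by positivity), Real.norm_of_nonneg (le_trans (by positivity) (hlow t)),
    ← div_eq_inv_mul, le_div_iff₀ hc'0, mul_comm]
  exact hlow t

end Gap

/-! ### Spectral theory of the weight matrix -/

section Network

variable {n m : ℕ} {A : Matrix (Fin n) (Fin n) ℝ}

theorem IsNetwork.apply_comm (hA : IsNetwork A) (i j : Fin n) : A i j = A j i :=
  hA.symm.apply j i

theorem IsNetwork.nonempty (hA : IsNetwork A) : Nonempty (Fin n) := hA.connected.nonempty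

theorem IsNetwork.sum_sum_smul {V : Type*} [AddCommGroup V] [Module ℝ V] (hA : IsNetwork A)
    (u : Fin n → V) : ∑ i, ∑ j, A i j • u j = ∑ j, u j := by
  rw [Finset.sum_comm]
  refine Finset.sum_congr rfl fun j _ => ?_
  rw [← Finset.sum_smul, Finset.sum_congr rfl fun i _ => hA.apply_comm i j, hA.row_sum, one_smul]

/-- The Dirichlet forms of an eigenvector `u`; their nonnegativity confines the eigenvalue to
`[-1, 1]`. -/
theorem IsNetwork.sum_mul_sub_sq (hA : IsNetwork A) (u : Fin n → ℝ) {d : ℝ}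
    (hd : ∀ i, ∑ j, A i j * u j = d * u i) :
    ∑ i, ∑ j, A i j * (u i - u j) ^ 2 = 2 * (1 - d) * ∑ i, u i ^ 2 ∧
    ∑ i, ∑ j, A i j * (u i + u j) ^ 2 = 2 * (1 + d) * ∑ i, u i ^ 2 := by
  have h1 : ∑ i, ∑ j, A i j * u i ^ 2 = ∑ i, u i ^ 2 := by
    refine Finset.sum_congr rfl fun i _ => ?_
    rw [← Finset.sum_mul, hA.row_sum, one_mul]
  have h2 : ∑ i, ∑ j, A i j * u j ^ 2 = ∑ i, u i ^ 2 := by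
    simpa [smul_eq_mul] using hA.sum_sum_smul (fun i => u i ^ 2)
  have h3 : ∑ i, ∑ j, A i j * (u i * u j) = d * ∑ i, u i ^ 2 := by
    rw [Finset.mul_sum]
    refine Finset.sum_congr rfl fun i _ => ?_
    rw [show d * u i ^ 2 = u i * (d * u i) by ring, ← hd i, Finset.mul_sum]
    exact Finset.sum_congr rfl fun j _ => by ring
  constructor
  · have : ∀ i j, A i j * (u i - u j) ^ 2 =
        A i j * u i ^ 2 + A i j * u j ^ 2 - 2 * (A i j * (u i * u j)) := fun i j => by ring
    simp only [this, Finset.sum_sub_distrib, Finset.sum_add_distrib, ← Finset.mul_sum, h1, h2, h3]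
    ring
  · have : ∀ i j, A i j * (u i + u j) ^ 2 =
        A i j * u i ^ 2 + A i j * u j ^ 2 + 2 * (A i j * (u i * u j)) := fun i j => by ring
    simp only [this, Finset.sum_add_distrib, ← Finset.mul_sum, h1, h2, h3]
    ring

/-- Every eigenvector for the eigenvalue `1` is constant, because the graph is connected. -/
theorem IsNetwork.eq_of_fixed (hA : IsNetwork A) (u : Fin n → ℝ)
    (hu : ∀ i, ∑ j, A i j * u j = u i) (i j : Fin n) : u i = u j := by
  have h := (hA.sum_mul_sub_sq u (d := 1) (fun i => by rw [hu, one_mul])).1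
  rw [sub_self, mul_zero, zero_mul] at h
  have h0 : ∀ i j, 0 ≤ A i j * (u i - u j) ^ 2 := fun i j =>
    mul_nonneg (hA.nonneg i j) (sq_nonneg _)
  have hz : ∀ i j, A i j * (u i - u j) ^ 2 = 0 := by
    intro i j
    have h1 := (Finset.sum_eq_zero_iff_of_nonneg
      (fun i _ => Finset.sum_nonneg fun j _ => h0 i j)).1 h i (Finset.mem_univ _)
    exact (Finset.sum_eq_zero_iff_of_nonneg (fun j _ => h0 i j)).1 h1 j (Finset.mem_univ _)
  have hadj : ∀ i j, (weightGraph A).Adj i j → u i = u j := by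
    intro i j hij
    have hne : A i j ≠ 0 := by
      rw [weightGraph, SimpleGraph.fromRel_adj] at hij
      rcases hij.2 with h | h
      · exact h
      · rwa [hA.apply_comm i j]
    rcases mul_eq_zero.1 (hz i j) with h | h
    · exact absurd h hne
    · exact sub_eq_zero.1 (pow_eq_zero_iff two_ne_zero |>.1 h)
  obtain ⟨p⟩ := hA.connected.preconnected i j
  induction p with
  | nil => rfl
  | cons h _ ih => exact (hadj _ _ h).trans ih

/-- An orthonormal eigenbasis of the weight matrix, with the only information on the spectrum that
is used: the eigenvalues lie in the spectrum, apart from `1` they have modulus at most some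
`ρ < 1`, and the eigenvectors for `1` are orthogonal to the profiles of zero mean. -/
theorem IsNetwork.exists_eigenbasis (hA : IsNetwork A) :
    ∃ (β : OrthonormalBasis (Fin n) ℝ (EuclideanSpace ℝ (Fin n))) (d : Fin n → ℝ) (ρ : ℝ),
      0 ≤ ρ ∧ ρ < 1 ∧
      (∀ k u, inner ℝ (β k) (WithLp.toLp 2 (A.mulVec u)) = d k * inner ℝ (β k) (WithLp.toLp 2 u)) ∧
      (∀ k, d k ∈ spectrum ℝ A) ∧
      (∀ k, (|d k| ≤ ρ) ∨ ∀ u : Fin n → ℝ, ∑ i, u i = 0 → inner ℝ (β k) (WithLp.toLp 2 u) = 0) := by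
  have hH : A.IsHermitian := by
    rw [Matrix.IsHermitian, Matrix.conjTranspose_eq_transpose_of_trivial]
    exact hA.symm
  have := hA.nonempty
  set β := hH.eigenvectorBasis
  set d := hH.eigenvalues
  have heig : ∀ k, A.mulVec (β k) = d k • ⇑(β k) := hH.mulVec_eigenvectorBasis
  have hspec : ∀ k, d k ∈ spectrum ℝ A := fun k => hH.eigenvalues_mem_spectrum_real k
  have heig' : ∀ k i, ∑ j, A i j * β k j = d k * β k i := fun k i => congrFun (heig k) i
  have hpos : ∀ k, 0 < ∑ i, β k i ^ 2 := by
    intro k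
    have h1 := β.orthonormal.1 k
    have h2 := EuclideanSpace.norm_sq_eq (β k)
    rw [h1] at h2
    simp only [Real.norm_eq_abs, sq_abs, one_pow] at h2
    rw [← h2]; exact one_pos
  have hle : ∀ k, |d k| ≤ 1 := by
    intro k
    obtain ⟨h1, h2⟩ := hA.sum_mul_sub_sq (fun i => β k i) (heig' k)
    have h3 : 0 ≤ 2 * (1 - d k) * ∑ i, β k i ^ 2 := by
      rw [← h1]
      exact Finset.sum_nonneg fun i _ => Finset.sum_nonneg fun j _ =>
        mul_nonneg (hA.nonneg i j) (sq_nonneg _)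
    have h4 : 0 ≤ 2 * (1 + d k) * ∑ i, β k i ^ 2 := by
      rw [← h2]
      exact Finset.sum_nonneg fun i _ => Finset.sum_nonneg fun j _ =>
        mul_nonneg (hA.nonneg i j) (sq_nonneg _)
    have h5 := nonneg_of_mul_nonneg_left h3 (hpos k)
    have h6 := nonneg_of_mul_nonneg_left h4 (hpos k)
    rw [abs_le]; constructor <;> linarith
  have hlt : ∀ k, d k ≠ 1 → |d k| < 1 := by
    intro k hk
    refine lt_of_le_of_ne (hle k) fun h => ?_
    rcases eq_or_eq_neg_of_abs_eq h with h | h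
    · exact hk h
    · exact hA.neg_one (h ▸ hspec k)
  set f : Fin n → ℝ := fun k => if d k = 1 then 0 else |d k| with hf
  set ρ := Finset.univ.sup' Finset.univ_nonempty f with hρ
  have hfρ : ∀ k, f k ≤ ρ := fun k => Finset.le_sup' f (Finset.mem_univ k)
  have hf0 : ∀ k, 0 ≤ f k := fun k => by
    simp only [hf]; split_ifs
    · exact le_rfl
    · exact abs_nonneg _
  refine ⟨β, d, ρ, ?_, ?_, ?_, hspec, ?_⟩
  · exact (hf0 (Classical.arbitrary _)).trans (hfρ _)
  · rw [hρ, Finset.sup'_lt_iff]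
    intro k _
    simp only [hf]; split_ifs with h
    · exact one_pos
    · exact hlt k h
  · intro k u
    have e1 : ∀ v : Fin n → ℝ, inner ℝ (β k) (WithLp.toLp 2 v) = (β k : Fin n → ℝ) ⬝ᵥ v := by
      intro v
      rw [PiLp.inner_apply, dotProduct]
      exact Finset.sum_congr rfl fun i _ => by simp [mul_comm]
    rw [e1, e1, Matrix.dotProduct_mulVec, ← Matrix.mulVec_transpose, hA.symm.eq]
    rw [show A.mulVec (β k) = d k • (β k : Fin n → ℝ) from heig k, smul_dotProduct, smul_eq_mul]
  · intro k
    by_cases h : d k = 1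
    · right
      intro u hu
      have hc := hA.eq_of_fixed (fun i => β k i) (fun i => by rw [heig', h, one_mul])
      rw [PiLp.inner_apply]
      have : ∀ i, inner ℝ (β k i) (u i) = β k (Classical.arbitrary _) * u i := by
        intro i
        rw [hc (Classical.arbitrary _) i]
        simp [mul_comm]
      simp only [this]
      rw [← Finset.mul_sum, hu, mul_zero]
    · left
      have := hfρ k
      simpa only [hf, if_neg h] using this

theorem sum_sq_eq_sum_inner_sq (β : OrthonormalBasis (Fin n) ℝ (EuclideanSpace ℝ (Fin n)))
    (u : Fin n → ℝ) : ∑ i, u i ^ 2 = ∑ k, (inner ℝ (β k) (WithLp.toLp 2 u)) ^ 2 := by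
  have h := β.sum_sq_norm_inner_right (WithLp.toLp 2 u)
  rw [EuclideanSpace.norm_sq_eq] at h
  simpa [Real.norm_eq_abs, sq_abs] using h.symm

/-- The three spectral estimates on scalar profiles: contraction of `A` and coercivity of `1 - A`
on zero mean, and the norm bound of `1 - A` inherited from its spectrum. -/
theorem IsNetwork.exists_bounds (hA : IsNetwork A) :
    ∃ ρ, 0 ≤ ρ ∧ ρ < 1 ∧
      (∀ u : Fin n → ℝ, ∑ i, u i = 0 →
        ∑ i, (∑ j, A i j * u j) ^ 2 ≤ ρ ^ 2 * ∑ i, u i ^ 2 ∧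
        (1 - ρ) ^ 2 * ∑ i, u i ^ 2 ≤ ∑ i, (u i - ∑ j, A i j * u j) ^ 2) ∧
      ∀ κ μ : ℝ, (∀ l ∈ spectrum ℝ (1 - A), κ * l ^ 2 < μ) →
        ∃ μ' < μ, ∀ u : Fin n → ℝ,
          κ * ∑ i, (u i - ∑ j, A i j * u j) ^ 2 ≤ μ' * ∑ i, u i ^ 2 := by
  obtain ⟨β, d, ρ, hρ0, hρ1, hβ, hspec, hd⟩ := hA.exists_eigenbasis
  have := hA.nonempty
  have eA : ∀ u : Fin n → ℝ, ∑ i, (∑ j, A i j * u j) ^ 2 =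
      ∑ k, d k ^ 2 * (inner ℝ (β k) (WithLp.toLp 2 u)) ^ 2 := by
    intro u
    have h := sum_sq_eq_sum_inner_sq β (A.mulVec u)
    simp only [hβ, mul_pow] at h
    exact h
  have eW : ∀ u : Fin n → ℝ, ∑ i, (u i - ∑ j, A i j * u j) ^ 2 =
      ∑ k, (1 - d k) ^ 2 * (inner ℝ (β k) (WithLp.toLp 2 u)) ^ 2 := by
    intro u
    have h := sum_sq_eq_sum_inner_sq β (u - A.mulVec u)
    rw [WithLp.toLp_sub] at h
    simp only [inner_sub_right, hβ] at h
    refine Eq.trans h (Finset.sum_congr rfl fun k _ => ?_)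
    ring
  refine ⟨ρ, hρ0, hρ1, fun u hu => ⟨?_, ?_⟩, fun κ μ hκ => ?_⟩
  · rw [eA, sum_sq_eq_sum_inner_sq β u, Finset.mul_sum]
    refine Finset.sum_le_sum fun k _ => ?_
    rcases hd k with h | h
    · refine mul_le_mul_of_nonneg_right ?_ (sq_nonneg _)
      rw [← sq_abs]; exact pow_le_pow_left₀ (abs_nonneg _) h 2
    · rw [h u hu]; simp
  · rw [eW, sum_sq_eq_sum_inner_sq β u, Finset.mul_sum]
    refine Finset.sum_le_sum fun k _ => ?_
    rcases hd k with h | h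
    · refine mul_le_mul_of_nonneg_right ?_ (sq_nonneg _)
      exact pow_le_pow_left₀ (by linarith) (by linarith [le_abs_self (d k)]) 2
    · rw [h u hu]; simp
  · set f : Fin n → ℝ := fun k => κ * (1 - d k) ^ 2 with hf
    refine ⟨Finset.univ.sup' Finset.univ_nonempty f, ?_, fun u => ?_⟩
    · rw [Finset.sup'_lt_iff]
      intro k _
      refine hκ _ ?_
      rw [← map_one (algebraMap ℝ (Matrix (Fin n) (Fin n) ℝ)), ← spectrum.singleton_sub_eq]
      exact Set.sub_mem_sub rfl (hspec k)
    · rw [eW, sum_sq_eq_sum_inner_sq β u, Finset.mul_sum, Finset.mul_sum]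
      refine Finset.sum_le_sum fun k _ => ?_
      rw [← mul_assoc]
      exact mul_le_mul_of_nonneg_right (Finset.le_sup' f (Finset.mem_univ k)) (sq_nonneg _)

/-! ### Profiles of vectors and the network Laplacian -/

/-- Profiles of `n` vectors of `ℝ^m`, with the Euclidean norm of the product. -/
abbrev Profile (n m : ℕ) := PiLp 2 fun _ : Fin n => E m

theorem Profile.norm_sq_eq (u : Profile n m) : ‖u‖ ^ 2 = ∑ q, ∑ i, (u i q) ^ 2 := by
  rw [PiLp.norm_sq_eq_of_L2, Finset.sum_comm]
  refine Finset.sum_congr rfl fun i _ => ?_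
  rw [EuclideanSpace.norm_sq_eq]
  simp

/-- The Laplacian `1 - A` acting on profiles of vectors. -/
noncomputable def lap (A : Matrix (Fin n) (Fin n) ℝ) : Profile n m →ₗ[ℝ] Profile n m where
  toFun u := WithLp.toLp 2 fun i => u i - ∑ j, A i j • u j
  map_add' u v := by
    ext i q
    simp only [PiLp.add_apply, smul_add, Finset.sum_add_distrib, PiLp.sub_apply]
    ring
  map_smul' c u := by
    ext i q
    simp only [PiLp.smul_apply, PiLp.sub_apply, smul_eq_mul, RingHom.id_apply, WithLp.ofLp_sum,
      WithLp.ofLp_smul, Finset.sum_apply, Pi.smul_apply, mul_sub, Finset.mul_sum]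
    congr 1
    exact Finset.sum_congr rfl fun j _ => by ring

theorem lap_apply (u : Profile n m) (i : Fin n) : lap A u i = u i - ∑ j, A i j • u j := rfl

theorem lap_apply_apply (u : Profile n m) (i : Fin n) (q : Fin m) :
    lap A u i q = u i q - ∑ j, A i j * u j q := by
  simp [lap_apply]

theorem IsNetwork.lap_isSymmetric (hA : IsNetwork A) (u v : Profile n m) :
    inner ℝ (lap A u) v = inner ℝ u (lap A v) := by
  simp only [PiLp.inner_apply (𝕜 := ℝ) (f := fun _ : Fin n => E m), lap_apply, inner_sub_left,
    inner_sub_right, sum_inner, inner_sum, real_inner_smul_left, real_inner_smul_right,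
    Finset.sum_sub_distrib]
  congr 1
  rw [Finset.sum_comm]
  exact Finset.sum_congr rfl fun i _ => Finset.sum_congr rfl fun j _ => by rw [hA.apply_comm]

theorem IsNetwork.sum_lap (hA : IsNetwork A) (u : Profile n m) : ∑ i, lap A u i = 0 := by
  simp only [lap_apply, Finset.sum_sub_distrib, hA.sum_sum_smul, sub_self]

theorem IsNetwork.lap_const (hA : IsNetwork A) (s : E m) :
    lap A (WithLp.toLp 2 fun _ => s : Profile n m) = 0 := by
  ext1 i
  rw [lap_apply]
  simp [← Finset.sum_smul, hA.row_sum]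

theorem IsNetwork.exists_lap_bounds (hA : IsNetwork A) (m : ℕ) :
    (∃ c > 0, ∀ u : Profile n m, ∑ i, u i = 0 → c * ‖u‖ ≤ ‖lap A u‖) ∧
    ∀ κ μ : ℝ, (∀ l ∈ spectrum ℝ (1 - A), κ * l ^ 2 < μ) →
      ∃ μ' < μ, ∀ u : Profile n m, κ * ‖lap A u‖ ^ 2 ≤ μ' * ‖u‖ ^ 2 := by
  obtain ⟨ρ, hρ0, hρ1, h1, h2⟩ := hA.exists_bounds
  refine ⟨⟨1 - ρ, by linarith, fun u hu => ?_⟩, fun κ μ hκ => ?_⟩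
  · refine le_of_sq_le_sq ?_ (norm_nonneg _)
    rw [mul_pow, Profile.norm_sq_eq, Profile.norm_sq_eq, Finset.mul_sum]
    refine Finset.sum_le_sum fun q _ => ?_
    simp only [lap_apply_apply]
    refine (h1 (fun i => u i q) ?_).2
    have := congrArg (fun w : E m => w q) hu
    simpa using this
  · obtain ⟨μ', hμ', h⟩ := h2 κ μ hκ
    refine ⟨μ', hμ', fun u => ?_⟩
    rw [Profile.norm_sq_eq, Profile.norm_sq_eq, Finset.mul_sum, Finset.mul_sum]
    refine Finset.sum_le_sum fun q _ => ?_
    simp only [lap_apply_apply]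
    exact h fun i => u i q

/-- The Laplacian of a network is onto the profiles of zero mean, already from these. -/
theorem IsNetwork.exists_lap_eq (hA : IsNetwork A) (w : Profile n m) (hw : ∑ i, w i = 0) :
    ∃ u : Profile n m, ∑ i, u i = 0 ∧ lap A u = w := by
  obtain ⟨c, hc, hlow⟩ := (hA.exists_lap_bounds m).1
  let K : Submodule ℝ (Profile n m) :=
    { carrier := {u | ∑ i, u i = 0}
      zero_mem' := by simp
      add_mem' := fun {u v} hu hv => by
        simp only [Set.mem_ofPred_eq, PiLp.add_apply, Finset.sum_add_distrib] at *
        rw [hu, hv, add_zero]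
      smul_mem' := fun r u hu => by
        simp only [Set.mem_ofPred_eq, PiLp.smul_apply, ← Finset.smul_sum] at *
        rw [hu, smul_zero] }
  let f : K →ₗ[ℝ] K := (lap A).restrict (p := K) (q := K) fun u _ => hA.sum_lap u
  have hinj : Function.Injective f := by
    rw [← LinearMap.ker_eq_bot, LinearMap.ker_eq_bot']
    intro u hu
    have h1 := hlow u u.2
    have h2 : lap A (u : Profile n m) = 0 := congrArg Subtype.val hu
    rw [h2, norm_zero] at h1
    have h3 : ‖(u : Profile n m)‖ = 0 :=
      le_antisymm (nonpos_of_mul_nonpos_right h1 hc) (norm_nonneg _)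
    exact Subtype.ext (norm_eq_zero.1 h3)
  obtain ⟨u, hu⟩ := LinearMap.injective_iff_surjective.1 hinj ⟨w, hw⟩
  exact ⟨u, u.2, congrArg Subtype.val hu⟩

/-! ### Dynamic average consensus -/

/-- Trackers that mix by `A` and add the increments of local signals follow the sum of the signals
up to the order of the increments. -/
theorem IsNetwork.tracking_isBigO (hA : IsNetwork A) {u h : ℕ → Fin n → ℝ} {η : ℕ → ℝ}
    (hη : ∀ t, 0 < η t) (hlim : Tendsto (fun t => η (t + 1) / η t) atTop (𝓝 1))
    (h0 : ∀ i, u 0 i = h 0 i)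
    (hrec : ∀ t i, u (t + 1) i = ∑ j, A i j * u t j + h (t + 1) i - h t i)
    (hinc : ∀ i, (fun t => h (t + 1) i - h t i) =O[atTop] η) (i : Fin n) :
    (fun t => n * u t i - ∑ j, h t j) =O[atTop] η := by
  obtain ⟨ρ, hρ0, hρ1, hρ, -⟩ := hA.exists_bounds
  have hsum : ∀ t, ∑ i, u t i = ∑ i, h t i := by
    intro t
    induction t with
    | zero => exact Finset.sum_congr rfl fun i _ => h0 i
    | succ t ih =>
      simp only [hrec, Finset.sum_sub_distrib, Finset.sum_add_distrib]
      have := hA.sum_sum_smul (u t)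
      simp only [smul_eq_mul] at this
      rw [this, ih]; ring
  set e : ℕ → Fin n → ℝ := fun t i => n * u t i - ∑ j, h t j with he
  set g : ℕ → Fin n → ℝ := fun t i =>
    n * (h (t + 1) i - h t i) - ∑ j, (h (t + 1) j - h t j) with hg
  have he0 : ∀ t, ∑ i, e t i = 0 := by
    intro t
    simp only [he, Finset.sum_sub_distrib, ← Finset.mul_sum, hsum, Finset.sum_const,
      Finset.card_univ, Fintype.card_fin, nsmul_eq_mul, sub_self]
  have herec : ∀ t i, e (t + 1) i = ∑ j, A i j * e t j + g t i := by
    intro t i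
    simp only [he, hg, hrec, mul_sub, Finset.sum_sub_distrib, ← Finset.sum_mul, hA.row_sum, one_mul]
    have : ∑ j, A i j * (n * u t j) = n * ∑ j, A i j * u t j := by
      rw [Finset.mul_sum]; exact Finset.sum_congr rfl fun j _ => by ring
    rw [this]; ring
  have hgO : ∀ i, (fun t => g t i) =O[atTop] η := fun i =>
    ((hinc i).const_mul_left _).sub (IsBigO.fun_sum fun j _ => hinc j)
  have hnorm : ∀ v : Fin n → ℝ, ‖(WithLp.toLp 2 v : EuclideanSpace ℝ (Fin n))‖ ^ 2 = ∑ i, v i ^ 2 := by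
    intro v; rw [EuclideanSpace.norm_sq_eq]; simp
  have hgO' : (fun t => (WithLp.toLp 2 (g t) : EuclideanSpace ℝ (Fin n))) =O[atTop] η := by
    have : (fun t => g t) =O[atTop] η := isBigO_pi.2 hgO
    exact ((PiLp.continuousLinearEquiv 2 ℝ (fun _ : Fin n => ℝ)).symm.toContinuousLinearMap.isBigO_comp
      g atTop).trans this
  have hE : (fun t => ‖(WithLp.toLp 2 (e t) : EuclideanSpace ℝ (Fin n))‖) =O[atTop] η := by
    refine isBigO_of_contraction hρ1 hη hlim (fun t => norm_nonneg _) hgO'.norm_left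
      (Eventually.of_forall fun t => ?_) hρ0
    have e1 : (WithLp.toLp 2 (e (t + 1)) : EuclideanSpace ℝ (Fin n)) =
        WithLp.toLp 2 (fun i => ∑ j, A i j * e t j) + WithLp.toLp 2 (g t) := by
      ext i; exact herec t i
    rw [e1]
    refine (norm_add_le _ _).trans (add_le_add_left ?_ _)
    refine le_of_sq_le_sq ?_ (by positivity)
    rw [mul_pow, hnorm, hnorm]
    exact (hρ (e t) (he0 t)).1
  refine IsBigO.trans (IsBigO.of_bound 1 (Eventually.of_forall fun t => ?_)) hE
  rw [one_mul, norm_norm]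
  exact PiLp.norm_apply_le (WithLp.toLp 2 (e t) : EuclideanSpace ℝ (Fin n)) i

/-! ### The primal-dual iteration at a frozen strategy profile -/

/-- One primal-dual step contracts the squared distance to the saddle point `(ys, ls)`. The squared
distances decrease by multiples of `‖y - ys‖²` and `‖y' - y‖²`; these control `W (l - ls)`, and
thereby `l - ls`, because `W` is coercive along it. -/
theorem primalDual_step {Y : Type*} [NormedAddCommGroup Y] [InnerProductSpace ℝ Y] (W : Y →ₗ[ℝ] Y)
    (hW : ∀ u v, inner ℝ (W u) v = inner ℝ u (W v)) {κ μ μ' L c ε : ℝ} (hκ : 0 < κ)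
    (hμ' : μ' ≤ μ) (hε0 : 0 ≤ ε) (hc : 0 < c)
    (hε1 : ε * (c ^ 2 + 2 * L ^ 2) ≤ κ * μ * c ^ 2) (hε2 : 2 * ε ≤ (1 - κ * L) * (c ^ 2 * κ ^ 2))
    {y y' l l' ys ls G Gs : Y} (hy : y' = y + κ • (- W l - G)) (hl : l' = l + κ • W y')
    (hys : W ys = 0) (hls : W ls = - Gs)
    (h3 : μ / 2 * (‖y - ys‖ ^ 2 + ‖y' - ys‖ ^ 2) - L / 2 * ‖y' - y‖ ^ 2 ≤
      inner ℝ (G - Gs) (y' - ys))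
    (hG : ‖G - Gs‖ ≤ L * ‖y - ys‖) (hW1 : κ * ‖W (y' - ys)‖ ^ 2 ≤ μ' * ‖y' - ys‖ ^ 2)
    (hW2 : c * ‖l - ls‖ ≤ ‖W (l - ls)‖) :
    ‖y' - ys‖ ^ 2 + ‖l' - ls‖ ^ 2 ≤ (1 - ε) * (‖y - ys‖ ^ 2 + ‖l - ls‖ ^ 2) := by
  set p := y - ys with hp
  set p' := y' - ys with hp'
  set r := l - ls with hr
  set h := G - Gs with hh
  set D := y' - y with hD
  have eD : D = - (κ • (W r + h)) := by
    rw [hD, hy, hr, hh, map_sub, hls]; module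
  have er' : l' - ls = r + κ • W p' := by
    rw [hl, hr, hp', map_sub, hys]; module
  have ep : p = p' - D := by rw [hp, hp', hD]; abel
  clear_value p' r h D
  -- the two cross terms `± 2κ ⟪W r, p'⟫` cancel
  have e1 : ‖p‖ ^ 2 = ‖p'‖ ^ 2 + 2 * κ * inner ℝ (W r) p' + 2 * κ * inner ℝ h p' + ‖D‖ ^ 2 := by
    rw [ep, norm_sub_sq_real, real_inner_comm]
    conv_lhs => rw [eD]
    rw [inner_neg_left, real_inner_smul_left, inner_add_left, ← eD]
    ring
  have e2 : ‖l' - ls‖ ^ 2 = ‖r‖ ^ 2 + 2 * κ * inner ℝ (W r) p' + κ * (κ * ‖W p'‖ ^ 2) := by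
    rw [er', norm_add_sq_real, inner_smul_right, norm_smul, Real.norm_of_nonneg hκ.le, ← hW]
    ring
  have e3 : κ * ‖W r‖ ≤ ‖D‖ + κ * (L * ‖p‖) := by
    have : κ • W r = - D - κ • h := by rw [eD]; module
    calc κ * ‖W r‖ = ‖κ • W r‖ := by rw [norm_smul, Real.norm_of_nonneg hκ.le]
      _ ≤ ‖D‖ + ‖κ • h‖ := by rw [this]; exact (norm_sub_le _ _).trans (by rw [norm_neg])
      _ ≤ _ := by rw [norm_smul, Real.norm_of_nonneg hκ.le]; gcongr
  have e4 : c ^ 2 * κ ^ 2 * ‖r‖ ^ 2 ≤ 2 * ‖D‖ ^ 2 + 2 * κ ^ 2 * L ^ 2 * ‖p‖ ^ 2 := by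
    have h1 : κ * (c * ‖r‖) ≤ ‖D‖ + κ * (L * ‖p‖) :=
      (mul_le_mul_of_nonneg_left hW2 hκ.le).trans e3
    have h2 := pow_le_pow_left₀ (by positivity) h1 2
    nlinarith [sq_nonneg (‖D‖ - κ * (L * ‖p‖))]
  have e5 := mul_le_mul_of_nonneg_left hW1 hκ.le
  have e6 := mul_le_mul_of_nonneg_left h3 hκ.le
  have e7 : κ * (μ' * ‖p'‖ ^ 2) ≤ κ * (μ * ‖p'‖ ^ 2) := by gcongr
  have hV : ‖p'‖ ^ 2 + ‖l' - ls‖ ^ 2 ≤ ‖p‖ ^ 2 + ‖r‖ ^ 2 - κ * μ * ‖p‖ ^ 2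
      - (1 - κ * L) * ‖D‖ ^ 2 := by
    rw [e2]; linarith
  have hck : 0 < c ^ 2 * κ ^ 2 := by positivity
  have e8 : ε * (‖p‖ ^ 2 + ‖r‖ ^ 2) ≤ κ * μ * ‖p‖ ^ 2 + (1 - κ * L) * ‖D‖ ^ 2 := by
    refine le_of_mul_le_mul_left ?_ hck
    have f1 := mul_le_mul_of_nonneg_left e4 hε0
    have f2 := mul_le_mul_of_nonneg_right hε1 (mul_nonneg (sq_nonneg κ) (sq_nonneg ‖p‖))
    have f3 := mul_le_mul_of_nonneg_right hε2 (sq_nonneg ‖D‖)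
    linarith
  linarith

end Network

/-! ### Strongly convex functions with Lipschitz gradient -/

section Convex

variable {V : Type*} [NormedAddCommGroup V] [InnerProductSpace ℝ V]

/-- The derivative of a strongly monotone map is coercive. -/
theorem coercive_fderiv_of_monotone {G : V → V} {D : V →L[ℝ] V} {y : V} {μ : ℝ}
    (hG : ∀ x y, μ * ‖y - x‖ ^ 2 ≤ inner ℝ (G y - G x) (y - x)) (hD : HasFDerivAt G D y) (w : V) :
    μ * ‖w‖ ^ 2 ≤ inner ℝ (D w) w := by
  have h1 : HasDerivAt (fun s : ℝ => y + s • w) w 0 := by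
    simpa using ((hasDerivAt_id (0 : ℝ)).smul_const w).const_add y
  have h2 : HasDerivAt (fun s : ℝ => G (y + s • w)) (D w) 0 := by
    have h3 : HasFDerivAt G D (y + (0 : ℝ) • w) := by simpa using hD
    exact h3.comp_hasDerivAt 0 h1
  have h3 : Tendsto (fun s : ℝ => inner ℝ (slope (fun s : ℝ => G (y + s • w)) 0 s) w)
      (𝓝[≠] 0) (𝓝 (inner ℝ (D w) w)) :=
    (hasDerivAt_iff_tendsto_slope.1 h2).inner tendsto_const_nhds
  refine ge_of_tendsto h3 ?_
  filter_upwards [self_mem_nhdsWithin] with s hs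
  have hs' : s ≠ 0 := hs
  have h4 := hG y (y + s • w)
  rw [add_sub_cancel_left, norm_smul, inner_smul_right, mul_pow, Real.norm_eq_abs, sq_abs] at h4
  rw [slope_def_module, sub_zero, zero_smul, add_zero, real_inner_smul_left]
  have h5 : 0 < s ^ 2 := by positivity
  refine le_of_mul_le_mul_left ?_ h5
  calc s ^ 2 * (μ * ‖w‖ ^ 2) = μ * (s ^ 2 * ‖w‖ ^ 2) := by ring
    _ ≤ _ := h4
    _ = _ := by field_simp

variable [CompleteSpace V]

theorem hasDerivAt_comp_line {φ : V → ℝ} {d x v : V} {t : ℝ} (h : HasGradientAt φ v (x + t • d)) :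
    HasDerivAt (fun s : ℝ => φ (x + s • d)) (inner ℝ v d) t := by
  have h1 : HasDerivAt (fun s : ℝ => x + s • d) d t := by
    simpa using ((hasDerivAt_id t).smul_const d).const_add x
  have h2 := h.hasFDerivAt.comp_hasDerivAt t h1
  simpa using! h2

/-- The first order inequality for a function with `m`-monotone gradient, for any real `m`. -/
theorem first_order_of_monotone {φ : V → ℝ} {G : V → V} {m : ℝ} (hφ : ∀ y, HasGradientAt φ (G y) y)
    (hG : ∀ x y, m * ‖y - x‖ ^ 2 ≤ inner ℝ (G y - G x) (y - x)) (x y : V) :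
    φ x + inner ℝ (G x) (y - x) + m / 2 * ‖y - x‖ ^ 2 ≤ φ y := by
  set d := y - x with hd
  set ψ : ℝ → ℝ := fun t => φ (x + t • d) - t * inner ℝ (G x) d - m / 2 * ‖d‖ ^ 2 * t ^ 2 with hψ
  have hder : ∀ t, HasDerivAt ψ (inner ℝ (G (x + t • d)) d - inner ℝ (G x) d
      - m / 2 * ‖d‖ ^ 2 * (2 * t)) t := by
    intro t
    refine ((hasDerivAt_comp_line (hφ _)).sub ?_).sub ?_
    · simpa using (hasDerivAt_id t).mul_const (inner ℝ (G x) d)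
    · simpa using (hasDerivAt_pow 2 t).const_mul (m / 2 * ‖d‖ ^ 2)
  have hmono : MonotoneOn ψ (Set.Icc 0 1) := by
    refine monotoneOn_of_deriv_nonneg (convex_Icc 0 1)
      (fun t _ => (hder t).continuousAt.continuousWithinAt)
      (fun t _ => (hder t).differentiableAt.differentiableWithinAt) fun t ht => ?_
    rw [interior_Icc] at ht
    rw [(hder t).deriv]
    have h := hG x (x + t • d)
    rw [add_sub_cancel_left, norm_smul, Real.norm_of_nonneg ht.1.le, inner_smul_right,
      inner_sub_left, mul_pow] at h
    have h2 : t * (m * t * ‖d‖ ^ 2) ≤ t * (inner ℝ (G (x + t • d)) d - inner ℝ (G x) d) := by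
      linarith
    have h3 := le_of_mul_le_mul_left h2 ht.1
    linarith
  have h := hmono (Set.left_mem_Icc.2 zero_le_one) (Set.right_mem_Icc.2 zero_le_one) zero_le_one
  simp only [hψ, zero_smul, add_zero, zero_mul, sub_zero, one_smul, one_mul, one_pow, mul_one,
    ne_eq, OfNat.ofNat_ne_zero, not_false_eq_true, zero_pow, mul_zero] at h
  rw [show x + d = y by rw [hd]; abel] at h
  linarith

/-- A function below its chord on `[0, 1]` has endpoint slope at most that of the chord; the term
`c`, nonzero under strong convexity, is the gain. -/
theorem deriv_le_of_chord {ψ : ℝ → ℝ} {ψ' c : ℝ} (hψ : HasDerivWithinAt ψ ψ' (Set.Ioi 0) 0)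
    (h : ∀ t ∈ Set.Ioo (0 : ℝ) 1, ψ t ≤ (1 - t) * ψ 0 + t * ψ 1 - (1 - t) * t * c) :
    ψ' ≤ ψ 1 - ψ 0 - c := by
  have h1 := (hasDerivWithinAt_iff_tendsto_slope' Set.self_notMem_Ioi).1 hψ
  have h2 : Tendsto (fun t : ℝ => ψ 1 - ψ 0 - (1 - t) * c) (𝓝[>] 0) (𝓝 (ψ 1 - ψ 0 - (1 - 0) * c)) :=
    Tendsto.mono_left (Continuous.tendsto (by fun_prop) 0) nhdsWithin_le_nhds
  rw [sub_zero, one_mul] at h2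
  refine le_of_tendsto_of_tendsto h1 h2 ?_
  filter_upwards [Ioo_mem_nhdsGT (zero_lt_one (α := ℝ))] with t ht
  rw [slope_def_field, sub_zero, div_le_iff₀ ht.1]
  have := h t ht
  nlinarith

theorem StrongConvexOn.first_order {φ : V → ℝ} {v x : V} {μ : ℝ} (hφ : StrongConvexOn Set.univ μ φ)
    (hv : HasGradientAt φ v x) (y : V) :
    φ x + inner ℝ v (y - x) + μ / 2 * ‖y - x‖ ^ 2 ≤ φ y := by
  have h1 : HasDerivAt (fun s : ℝ => φ (x + s • (y - x))) (inner ℝ v (y - x)) 0 :=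
    hasDerivAt_comp_line (by simpa using hv)
  have h2 := deriv_le_of_chord (c := μ / 2 * ‖y - x‖ ^ 2) h1.hasDerivWithinAt ?_
  · simp only [one_smul, zero_smul, add_zero, add_sub_cancel] at h2
    linarith
  · intro t ht
    have h3 := hφ.2 (Set.mem_univ x) (Set.mem_univ y) (sub_nonneg.2 ht.2.le) ht.1.le
      (sub_add_cancel 1 t)
    rw [show x + t • (y - x) = (1 - t) • x + t • y by module, norm_sub_rev y x]
    simpa using h3

theorem StrongConvexOn.gradient_monotone {φ : V → ℝ} {G : V → V} {μ : ℝ}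
    (hφ : StrongConvexOn Set.univ μ φ) (hG : ∀ y, HasGradientAt φ (G y) y) (x y : V) :
    μ * ‖y - x‖ ^ 2 ≤ inner ℝ (G y - G x) (y - x) := by
  have h1 := StrongConvexOn.first_order hφ (hG x) y
  have h2 := StrongConvexOn.first_order hφ (hG y) x
  rw [norm_sub_rev x y, ← neg_sub y x, inner_neg_right] at h2
  rw [inner_sub_left]
  linarith

/-- The three point inequality: for a `μ`-strongly convex function with `L`-Lipschitz gradient a
gradient taken at the previous point `y` still points away from `s` at the next point `y'`. -/
theorem StrongConvexOn.three_point {φ : V → ℝ} {G : V → V} {μ L : ℝ}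
    (hφ : StrongConvexOn Set.univ μ φ) (hG : ∀ y, HasGradientAt φ (G y) y)
    (hL : ∀ x y, ‖G x - G y‖ ≤ L * ‖x - y‖) (y y' s : V) :
    μ / 2 * (‖y - s‖ ^ 2 + ‖y' - s‖ ^ 2) - L / 2 * ‖y' - y‖ ^ 2 ≤
      inner ℝ (G y - G s) (y' - s) := by
  have h1 := StrongConvexOn.first_order hφ (hG y) s
  have h2 := StrongConvexOn.first_order hφ (hG s) y'
  -- the descent lemma is the first order inequality for `-φ`, whose gradient is `-L`-monotone
  have h3 := first_order_of_monotone (φ := fun y => - φ y) (G := fun y => - G y) (m := -L)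
    (fun y => by
      have := (hG y).hasFDerivAt.neg
      rw [hasGradientAt_iff_hasFDerivAt, map_neg]
      exact this)
    (fun x y => by
      rw [← neg_sub', inner_neg_left]
      have := real_inner_le_norm (G y - G x) (y - x)
      nlinarith [hL y x, norm_nonneg (y - x)]) y y'
  rw [inner_neg_left] at h3
  rw [norm_sub_rev s y] at h1
  have e1 : inner ℝ (G y) (y' - s) = inner ℝ (G y) (y' - y) - inner ℝ (G y) (s - y) := by
    rw [← inner_sub_right]; congr 1; abel
  rw [inner_sub_left, e1]
  linarith

end Convex

/-! ### Matrices and second derivatives -/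

section Matrices

variable {p q : ℕ}

theorem frobenius_norm_sq (M : Matrix (Fin p) (Fin q) ℝ) : ‖M‖ ^ 2 = ∑ i, ∑ j, M i j ^ 2 := by
  rw [Matrix.frobenius_norm_def, ← Real.sqrt_eq_rpow, Real.sq_sqrt]
  · simp [sq_abs]
  · positivity

theorem toEuclideanLin_apply_coord (M : Matrix (Fin p) (Fin q) ℝ) (w : E q) (i : Fin p) :
    M.toEuclideanLin w i = ∑ j, M i j * w j := rfl

theorem norm_toEuclideanLin_le (M : Matrix (Fin p) (Fin q) ℝ) (w : E q) :
    ‖M.toEuclideanLin w‖ ≤ ‖M‖ * ‖w‖ := by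
  refine le_of_sq_le_sq ?_ (by positivity)
  rw [mul_pow, frobenius_norm_sq, EuclideanSpace.norm_sq_eq, EuclideanSpace.norm_sq_eq,
    Finset.sum_mul]
  refine Finset.sum_le_sum fun i _ => ?_
  simp only [Real.norm_eq_abs, sq_abs, toEuclideanLin_apply_coord]
  exact Finset.sum_mul_sq_le_sq_mul_sq _ _ _

theorem frobenius_norm_le_sum (M : Matrix (Fin p) (Fin q) ℝ) : ‖M‖ ≤ ∑ i, ∑ j, |M i j| := by
  refine le_of_sq_le_sq ?_ (by positivity)
  rw [frobenius_norm_sq]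
  have h : ∀ i, ∑ j, M i j ^ 2 ≤ (∑ j, |M i j|) ^ 2 := by
    intro i
    simp only [← sq_abs (M i _)]
    exact Finset.sum_sq_le_sq_sum_of_nonneg (f := fun j => |M i j|) fun j _ => abs_nonneg _
  exact (Finset.sum_le_sum fun i _ => h i).trans
    (Finset.sum_sq_le_sq_sum_of_nonneg (f := fun i => ∑ j, |M i j|)
      fun i _ => Finset.sum_nonneg fun j _ => abs_nonneg _)

theorem abs_entry_le_norm (M : Matrix (Fin p) (Fin q) ℝ) (i : Fin p) (j : Fin q) :
    |M i j| ≤ ‖M‖ := by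
  refine abs_le_of_sq_le_sq ?_ (norm_nonneg _)
  rw [frobenius_norm_sq]
  exact (Finset.single_le_sum (f := fun j => M i j ^ 2) (fun j _ => sq_nonneg _)
    (Finset.mem_univ j)).trans (Finset.single_le_sum (f := fun i => ∑ j, M i j ^ 2)
      (fun i _ => Finset.sum_nonneg fun j _ => sq_nonneg _) (Finset.mem_univ i))

theorem linear_apply_coord (D : E q →L[ℝ] E p) (w : E q) (i : Fin p) :
    D w i = ∑ j, D (EuclideanSpace.single j 1) i * w j := by
  conv_lhs => rw [← (EuclideanSpace.basisFun (Fin q) ℝ).sum_repr w]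
  simp [mul_comm]

variable {m₁ m₂ : ℕ}

theorem hess22_apply (f : E m₁ → E m₂ → ℝ) (x : E m₁) (y w : E m₂) :
    (hess22 f x y).toEuclideanLin w = fderiv ℝ (fun w => grad2 f x w) y w := by
  ext i
  rw [toEuclideanLin_apply_coord, linear_apply_coord]
  rfl

theorem inner_hess21 (f : E m₁ → E m₂ → ℝ) (x d : E m₁) (y z : E m₂) :
    inner ℝ ((hess21 f x y).toEuclideanLin z) d = inner ℝ z (fderiv ℝ (fun u => grad2 f u y) x d) := by
  simp only [PiLp.inner_apply, toEuclideanLin_apply_coord]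
  have e : ∀ i, fderiv ℝ (fun u => grad2 f u y) x d i =
      ∑ p, hess21 f x y p i * d p := fun i => linear_apply_coord _ _ _
  simp only [e, RCLike.inner_apply, conj_trivial, Finset.mul_sum, Finset.sum_mul]
  rw [Finset.sum_comm]
  exact Finset.sum_congr rfl fun i _ => Finset.sum_congr rfl fun j _ => by ring

theorem norm_fderiv_sub_le_hess22 (f : E m₁ → E m₂ → ℝ) (x x' : E m₁) (y y' : E m₂) :
    ‖fderiv ℝ (fun w => grad2 f x w) y - fderiv ℝ (fun w => grad2 f x' w) y'‖ ≤
      ‖hess22 f x y - hess22 f x' y'‖ := by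
  refine ContinuousLinearMap.opNorm_le_bound _ (norm_nonneg _) fun w => ?_
  rw [sub_apply, ← hess22_apply, ← hess22_apply, ← LinearMap.sub_apply,
    ← map_sub]
  exact norm_toEuclideanLin_le _ _

/-- Symmetry of the Hessian; only twice differentiability is needed, not continuity. -/
theorem hess22_symm {f : E m₁ → E m₂ → ℝ} {x : E m₁} (h1 : ∀ y, DifferentiableAt ℝ (f x) y)
    {y : E m₂} (h2 : DifferentiableAt ℝ (fun w => grad2 f x w) y) (v w : E m₂) :
    inner ℝ ((hess22 f x y).toEuclideanLin v) w = inner ℝ v ((hess22 f x y).toEuclideanLin w) := by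
  have hf : ∀ y, HasFDerivAt (f x) (innerSL ℝ (grad2 f x y)) y := fun y =>
    (h1 y).hasGradientAt.hasFDerivAt
  have h3 := (innerSL ℝ (E := E m₂)).hasFDerivAt.comp y h2.hasFDerivAt
  have h4 := second_derivative_symmetric hf h3 v w
  rw [hess22_apply, hess22_apply, real_inner_comm _ v]
  exact h4

end Matrices

/-! ### Lipschitz maps on a set -/

/-- `f` is Lipschitz on `S`, with an unspecified constant. -/
def LipOn {X W : Type*} [NormedAddCommGroup X] [NormedAddCommGroup W] (S : Set X) (f : X → W) :
    Prop :=
  ∃ C, 0 ≤ C ∧ ∀ x ∈ S, ∀ y ∈ S, ‖f x - f y‖ ≤ C * ‖x - y‖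

section LipOn

variable {X W W' : Type*} [NormedAddCommGroup X] [NormedAddCommGroup W] [NormedAddCommGroup W']
  {S : Set X}

theorem LipOn.add {f g : X → W} (hf : LipOn S f) (hg : LipOn S g) :
    LipOn S fun x => f x + g x := by
  obtain ⟨C, hC, h⟩ := hf
  obtain ⟨D, hD, h'⟩ := hg
  refine ⟨C + D, by positivity, fun x hx y hy => ?_⟩
  rw [add_sub_add_comm, add_mul]
  exact (norm_add_le _ _).trans (add_le_add (h x hx y hy) (h' x hx y hy))

theorem LipOn.sum {ι : Type*} {s : Finset ι} {f : ι → X → W} (hf : ∀ i ∈ s, LipOn S (f i)) :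
    LipOn S fun x => ∑ i ∈ s, f i x := by
  classical
  induction s using Finset.induction_on with
  | empty => exact ⟨0, le_rfl, fun x _ y _ => by simp⟩
  | insert i s hi ih =>
    simp only [Finset.sum_insert hi]
    exact (hf i (Finset.mem_insert_self _ _)).add
      (ih fun j hj => hf j (Finset.mem_insert_of_mem hj))

theorem LipOn.exists_bound {f : X → W} (hf : LipOn S f) (hS : Bornology.IsBounded S) :
    ∃ M, ∀ x ∈ S, ‖f x‖ ≤ M := by
  obtain ⟨C, hC, h⟩ := hf
  rcases S.eq_empty_or_nonempty with rfl | ⟨x₀, hx₀⟩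
  · exact ⟨0, fun x hx => hx.elim⟩
  obtain ⟨D, hD⟩ := Metric.isBounded_iff.1 hS
  refine ⟨‖f x₀‖ + C * D, fun x hx => ?_⟩
  have h1 := h x hx x₀ hx₀
  have h2 : ‖x - x₀‖ ≤ D := by rw [← dist_eq_norm]; exact hD hx hx₀
  calc ‖f x‖ = ‖f x₀ + (f x - f x₀)‖ := by congr 1; abel
    _ ≤ ‖f x₀‖ + ‖f x - f x₀‖ := norm_add_le _ _
    _ ≤ _ := by gcongr; exact h1.trans (by gcongr)

theorem LipOn.toEuclideanLin {p q : ℕ} {M : X → Matrix (Fin p) (Fin q) ℝ} {z : X → E q}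
    (hM : LipOn S M) (hz : LipOn S z) {KM Kz : ℝ} (hKM : ∀ x ∈ S, ‖M x‖ ≤ KM)
    (hKz : ∀ x ∈ S, ‖z x‖ ≤ Kz) : LipOn S fun x => (M x).toEuclideanLin (z x) := by
  obtain ⟨C, hC, h⟩ := hM
  obtain ⟨D, hD, h'⟩ := hz
  refine ⟨|KM| * D + C * |Kz|, by positivity, fun x hx y hy => ?_⟩
  have e : (M x).toEuclideanLin (z x) - (M y).toEuclideanLin (z y) =
      (M x).toEuclideanLin (z x - z y) + (M x - M y).toEuclideanLin (z y) := by
    simp only [map_sub, LinearMap.sub_apply]; abel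
  rw [e]
  calc _ ≤ ‖M x‖ * ‖z x - z y‖ + ‖M x - M y‖ * ‖z y‖ :=
        (norm_add_le _ _).trans (add_le_add (norm_toEuclideanLin_le _ _)
          (norm_toEuclideanLin_le _ _))
    _ ≤ |KM| * (D * ‖x - y‖) + (C * ‖x - y‖) * |Kz| := by
        gcongr
        · exact (hKM x hx).trans (le_abs_self _)
        · exact h' x hx y hy
        · exact h x hx y hy
        · exact (hKz y hy).trans (le_abs_self _)
    _ = _ := by ring

end LipOn

/-! ### The inner minimization problem -/

section Game

variable {n m₁ m₂ : ℕ} {μ L : ℝ} {Ω : Fin n → Set (E m₁)} {J g : Fin n → E m₁ → E m₂ → ℝ}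

theorem IsGame.hasGradientAt_inner (hgame : IsGame μ Ω J g) {i : Fin n} {u : E m₁} (hu : u ∈ Ω i)
    (y : E m₂) : HasGradientAt (g i u) (grad2 (g i) u y) y :=
  (hgame.diff_g2 i u hu y).hasGradientAt

theorem IsGame.grad2_monotone (hgame : IsGame μ Ω J g) {i : Fin n} {u : E m₁} (hu : u ∈ Ω i)
    (y y' : E m₂) :
    μ * ‖y' - y‖ ^ 2 ≤ inner ℝ (grad2 (g i) u y' - grad2 (g i) u y) (y' - y) :=
  StrongConvexOn.gradient_monotone (hgame.strong i u hu) (hgame.hasGradientAt_inner hu) y y'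

theorem IsGame.hess22_coercive (hgame : IsGame μ Ω J g) {i : Fin n} {u : E m₁} (hu : u ∈ Ω i)
    (y w : E m₂) : μ * ‖w‖ ^ 2 ≤ inner ℝ ((hess22 (g i) u y).toEuclideanLin w) w := by
  rw [hess22_apply]
  exact coercive_fderiv_of_monotone (hgame.grad2_monotone hu) (hgame.diff_g22 i u hu y).hasFDerivAt w

theorem IsGame.sum_first_order (hgame : IsGame μ Ω J g) {x : Fin n → E m₁}
    (hx : x ∈ Set.univ.pi Ω) (y y' : E m₂) :
    ∑ i, g i (x i) y + inner ℝ (∑ i, grad2 (g i) (x i) y) (y' - y) + n * (μ / 2 * ‖y' - y‖ ^ 2) ≤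
      ∑ i, g i (x i) y' := by
  have h : ∀ i ∈ Finset.univ, g i (x i) y + inner ℝ (grad2 (g i) (x i) y) (y' - y)
      + μ / 2 * ‖y' - y‖ ^ 2 ≤ g i (x i) y' := fun i _ =>
    StrongConvexOn.first_order (hgame.strong i _ (hx i trivial))
      (hgame.hasGradientAt_inner (hx i trivial) y) y'
  have h2 := Finset.sum_le_sum h
  rw [Finset.sum_add_distrib, Finset.sum_add_distrib, Finset.sum_const, Finset.card_univ,
    Fintype.card_fin, nsmul_eq_mul, ← sum_inner] at h2
  exact h2

theorem IsGame.isInnerMin_iff (hgame : IsGame μ Ω J g) (hμ : 0 < μ) {x : Fin n → E m₁}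
    (hx : x ∈ Set.univ.pi Ω) (y : E m₂) :
    IsInnerMin g x y ↔ ∑ i, grad2 (g i) (x i) y = 0 := by
  constructor
  · intro h
    have h1 : HasFDerivAt (fun y => ∑ i, g i (x i) y)
        (∑ i, innerSL ℝ (grad2 (g i) (x i) y)) y :=
      HasFDerivAt.fun_sum fun i _ => (hgame.hasGradientAt_inner (hx i trivial) y).hasFDerivAt
    have h2 : IsLocalMin (fun y => ∑ i, g i (x i) y) y := Eventually.of_forall h
    have h3 := h2.hasFDerivAt_eq_zero h1
    rw [← map_sum] at h3
    rw [← norm_eq_zero, innerSL_apply_norm, norm_eq_zero] at h3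
    exact h3
  · intro h y'
    have h1 := hgame.sum_first_order hx y y'
    rw [h, inner_zero_left, add_zero] at h1
    have : 0 ≤ n * (μ / 2 * ‖y' - y‖ ^ 2) := by positivity
    linarith

theorem IsGame.exists_isInnerMin (hgame : IsGame μ Ω J g) (hμ : 0 < μ) [Nonempty (Fin n)]
    {x : Fin n → E m₁} (hx : x ∈ Set.univ.pi Ω) : ∃ y, IsInnerMin g x y := by
  have hn : (1 : ℝ) ≤ n := by exact_mod_cast Fin.pos_iff_nonempty.2 ‹_›
  have hc : Continuous fun y => ∑ i, g i (x i) y :=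
    continuous_finsetSum _ fun i _ => continuous_iff_continuousAt.2 fun y =>
      (hgame.diff_g2 i _ (hx i trivial) y).continuousAt
  refine hc.exists_forall_le' 0 ?_
  set v := ∑ i, grad2 (g i) (x i) 0
  filter_upwards [(tendsto_norm_cocompact_atTop (E := E m₂)).eventually_ge_atTop (2 * ‖v‖ / μ)]
    with y hy
  have h := hgame.sum_first_order hx 0 y
  rw [sub_zero] at h
  have h1 : -(‖v‖ * ‖y‖) ≤ inner ℝ v y := neg_le_of_abs_le (abs_real_inner_le_norm v y)
  have h2 : 2 * ‖v‖ ≤ μ * ‖y‖ := by rwa [div_le_iff₀ hμ, mul_comm ‖y‖] at hy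
  have h3 := mul_le_mul_of_nonneg_right h2 (norm_nonneg y)
  have h4 : μ / 2 * ‖y‖ ^ 2 ≤ n * (μ / 2 * ‖y‖ ^ 2) := le_mul_of_one_le_left (by positivity) hn
  linarith

theorem IsGame.isInnerMin_aggr (hgame : IsGame μ Ω J g) (hμ : 0 < μ) [Nonempty (Fin n)]
    {x : Fin n → E m₁} (hx : x ∈ Set.univ.pi Ω) : IsInnerMin g x (aggr g x) :=
  Classical.epsilon_spec (hgame.exists_isInnerMin hμ hx)

theorem IsGame.sum_grad2_aggr (hgame : IsGame μ Ω J g) (hμ : 0 < μ) [Nonempty (Fin n)]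
    {x : Fin n → E m₁} (hx : x ∈ Set.univ.pi Ω) : ∑ i, grad2 (g i) (x i) (aggr g x) = 0 :=
  (hgame.isInnerMin_iff hμ hx _).1 (hgame.isInnerMin_aggr hμ hx)

theorem IsGame.eq_aggr (hgame : IsGame μ Ω J g) (hμ : 0 < μ) [Nonempty (Fin n)]
    {x : Fin n → E m₁} (hx : x ∈ Set.univ.pi Ω) {y : E m₂} (hy : IsInnerMin g x y) :
    y = aggr g x := by
  have hn : (1 : ℝ) ≤ n := by exact_mod_cast Fin.pos_iff_nonempty.2 ‹_›
  have h1 := hgame.sum_first_order hx (aggr g x) y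
  rw [hgame.sum_grad2_aggr hμ hx, inner_zero_left, add_zero] at h1
  have h2 := hy (aggr g x)
  have h4 : μ / 2 * ‖y - aggr g x‖ ^ 2 ≤ n * (μ / 2 * ‖y - aggr g x‖ ^ 2) :=
    le_mul_of_one_le_left (by positivity) hn
  have h5 : ‖y - aggr g x‖ ^ 2 ≤ 0 := by
    by_contra hc
    push Not at hc
    have : 0 < μ / 2 * ‖y - aggr g x‖ ^ 2 := by positivity
    linarith
  exact sub_eq_zero.1 (norm_eq_zero.1 (pow_eq_zero_iff two_ne_zero |>.1
    (le_antisymm h5 (sq_nonneg _))))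

/-- The aggregation is Lipschitz, with the constant `L / μ` for the sum norm. -/
theorem IsGame.norm_aggr_sub_le (hgame : IsGame μ Ω J g) (hμ : 0 < μ) (hLip : LipschitzData L Ω J g)
    [Nonempty (Fin n)] {x x' : Fin n → E m₁} (hx : x ∈ Set.univ.pi Ω) (hx' : x' ∈ Set.univ.pi Ω) :
    μ * ‖aggr g x - aggr g x'‖ ≤ L * ∑ i, ‖x i - x' i‖ := by
  set s := aggr g x with hs
  set s' := aggr g x' with hs'
  have hn : (1 : ℝ) ≤ n := by exact_mod_cast Fin.pos_iff_nonempty.2 ‹_›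
  have h1 : ∑ i : Fin n, μ * ‖s - s'‖ ^ 2 ≤
      ∑ i, inner ℝ (grad2 (g i) (x' i) s - grad2 (g i) (x' i) s') (s - s') :=
    Finset.sum_le_sum fun i _ => hgame.grad2_monotone (hx' i trivial) s' s
  rw [← sum_inner, Finset.sum_sub_distrib, hgame.sum_grad2_aggr hμ hx',
    ← hgame.sum_grad2_aggr hμ hx, ← Finset.sum_sub_distrib, Finset.sum_const, Finset.card_univ,
    Fintype.card_fin, nsmul_eq_mul] at h1
  have h2 : μ * ‖s - s'‖ ^ 2 ≤ n * (μ * ‖s - s'‖ ^ 2) := le_mul_of_one_le_left (by positivity) hn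
  have h3 : ‖∑ i, (grad2 (g i) (x' i) s - grad2 (g i) (x i) s)‖ ≤ L * ∑ i, ‖x i - x' i‖ := by
    rw [Finset.mul_sum]
    refine norm_sum_le_of_le _ fun i _ => ?_
    rw [norm_sub_rev (x i)]
    exact (hLip.lip_g2 i).1 _ (hx' i trivial) _ (hx i trivial) s
  have h4 := real_inner_le_norm (∑ i, (grad2 (g i) (x' i) s - grad2 (g i) (x i) s)) (s - s')
  rcases (norm_nonneg (s - s')).eq_or_lt with h0 | h0
  · rw [← h0, mul_zero]; exact (norm_nonneg _).trans h3
  · refine le_of_mul_le_mul_right ?_ h0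
    calc μ * ‖s - s'‖ * ‖s - s'‖ = μ * ‖s - s'‖ ^ 2 := by ring
      _ ≤ _ := (h2.trans h1).trans h4
      _ ≤ _ := mul_le_mul_of_nonneg_right h3 (norm_nonneg _)

theorem IsGame.lipOn_aggr (hgame : IsGame μ Ω J g) (hμ : 0 < μ) (hL : 0 ≤ L)
    (hLip : LipschitzData L Ω J g) [Nonempty (Fin n)] : LipOn (Set.univ.pi Ω) (aggr g) := by
  refine ⟨L * n / μ, by positivity, fun x hx x' hx' => ?_⟩
  have h := hgame.norm_aggr_sub_le hμ hLip hx hx'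
  have h2 : ∑ i, ‖x i - x' i‖ ≤ ∑ _i : Fin n, ‖x - x'‖ :=
    Finset.sum_le_sum fun i _ => norm_le_pi_norm (x - x') i
  rw [Finset.sum_const, Finset.card_univ, Fintype.card_fin, nsmul_eq_mul] at h2
  rw [div_mul_eq_mul_div, le_div_iff₀ hμ]
  have h3 := mul_le_mul_of_nonneg_left h2 hL
  linarith

theorem LipschitzEach.lipOn_comp {W : Type*} [NormedAddCommGroup W] {f : E m₁ → E m₂ → W}
    {i : Fin n} (hf : LipschitzEach L (Ω i) f) (hL : 0 ≤ L) {s : (Fin n → E m₁) → E m₂}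
    (hs : LipOn (Set.univ.pi Ω) s) : LipOn (Set.univ.pi Ω) fun x => f (x i) (s x) := by
  obtain ⟨C, hC, h⟩ := hs
  refine ⟨L + L * C, by positivity, fun x hx x' hx' => ?_⟩
  calc ‖f (x i) (s x) - f (x' i) (s x')‖
      = ‖(f (x i) (s x) - f (x' i) (s x)) + (f (x' i) (s x) - f (x' i) (s x'))‖ := by
        congr 1; abel
    _ ≤ L * ‖x i - x' i‖ + L * ‖s x - s x'‖ := (norm_add_le _ _).trans
        (add_le_add (hf.1 _ (hx i trivial) _ (hx' i trivial) _) (hf.2 _ (hx' i trivial) _ _))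
    _ ≤ L * ‖x - x'‖ + L * (C * ‖x - x'‖) := by
        gcongr
        · exact norm_le_pi_norm (x - x') i
        · exact h x hx x' hx'
    _ = _ := by ring

/-! ### The pseudo-gradient -/

/-- The Hessian `∑ j, ∇₂₂ g_j (x_j, σ(x))` of the inner objective at its minimizer. -/
noncomputable def innerHess (g : Fin n → E m₁ → E m₂ → ℝ) (x : Fin n → E m₁) :
    Matrix (Fin m₂) (Fin m₂) ℝ :=
  ∑ j, hess22 (g j) (x j) (aggr g x)

/-- The adjoint state of player `i`: the solution `z` of `innerHess · z = -∇₂ J_i (x_i, σ(x))`. -/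
noncomputable def adjointState (J g : Fin n → E m₁ → E m₂ → ℝ) (i : Fin n) (x : Fin n → E m₁) :
    E m₂ :=
  - ((innerHess g x)⁻¹).toEuclideanLin (grad2 (J i) (x i) (aggr g x))

/-- The explicit formula `∇₁ J_i + ∇₂₁ g_i z_i` for the pseudo-gradient, `z_i` the adjoint state. -/
noncomputable def explicitGrad (J g : Fin n → E m₁ → E m₂ → ℝ) (x : Fin n → E m₁) (i : Fin n) :
    E m₁ :=
  grad1 (J i) (x i) (aggr g x)
    + (hess21 (g i) (x i) (aggr g x)).toEuclideanLin (adjointState J g i x)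

theorem toEuclideanLin_sum {p q : ℕ} (M : Fin n → Matrix (Fin p) (Fin q) ℝ) (w : E q) :
    (∑ j, M j).toEuclideanLin w = ∑ j, (M j).toEuclideanLin w := by
  rw [map_sum, LinearMap.sum_apply]

/-- Coercivity of a sum of Hessians, taken at arbitrary points. -/
theorem IsGame.sum_hess22_coercive (hgame : IsGame μ Ω J g) {x : Fin n → E m₁}
    (hx : x ∈ Set.univ.pi Ω) (y : Fin n → E m₂) (w : E m₂) :
    n * μ * ‖w‖ ^ 2 ≤ inner ℝ ((∑ j, hess22 (g j) (x j) (y j)).toEuclideanLin w) w := by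
  rw [toEuclideanLin_sum, sum_inner]
  have h := Finset.sum_le_sum fun (i : Fin n) (_ : i ∈ Finset.univ) =>
    hgame.hess22_coercive (hx i trivial) (y i) w
  rw [Finset.sum_const, Finset.card_univ, Fintype.card_fin, nsmul_eq_mul, ← mul_assoc] at h
  exact h

theorem IsGame.le_norm_innerHess (hgame : IsGame μ Ω J g) (hμ : 0 < μ) [Nonempty (Fin n)]
    {x : Fin n → E m₁} (hx : x ∈ Set.univ.pi Ω) (w : E m₂) :
    μ * ‖w‖ ≤ ‖(innerHess g x).toEuclideanLin w‖ := by
  have hn : (1 : ℝ) ≤ n := by exact_mod_cast Fin.pos_iff_nonempty.2 ‹_›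
  have h1 := hgame.sum_hess22_coercive hx (fun _ => aggr g x) w
  have h2 := real_inner_le_norm ((innerHess g x).toEuclideanLin w) w
  have h3 : μ * ‖w‖ ^ 2 ≤ n * μ * ‖w‖ ^ 2 := by
    rw [mul_assoc]; exact le_mul_of_one_le_left (by positivity) hn
  rcases (norm_nonneg w).eq_or_lt with h0 | h0
  · rw [← h0, mul_zero]; exact norm_nonneg _
  · refine le_of_mul_le_mul_right ?_ h0
    calc μ * ‖w‖ * ‖w‖ = μ * ‖w‖ ^ 2 := by ring
      _ ≤ _ := (h3.trans h1).trans h2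

theorem IsGame.innerHess_adjointState (hgame : IsGame μ Ω J g) (hμ : 0 < μ) [Nonempty (Fin n)]
    {x : Fin n → E m₁} (hx : x ∈ Set.univ.pi Ω) (i : Fin n) :
    (innerHess g x).toEuclideanLin (adjointState J g i x) =
      - grad2 (J i) (x i) (aggr g x) := by
  have hinj : Function.Injective (innerHess g x).mulVec := by
    intro v w hvw
    have h := hgame.le_norm_innerHess hμ hx (WithLp.toLp 2 v - WithLp.toLp 2 w)
    rw [map_sub, Matrix.toLpLin_apply, Matrix.toLpLin_apply, hvw, sub_self,
      norm_zero] at h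
    have h0 : ‖(WithLp.toLp 2 v : E m₂) - WithLp.toLp 2 w‖ = 0 :=
      le_antisymm (nonpos_of_mul_nonpos_right h hμ) (norm_nonneg _)
    exact congrArg WithLp.ofLp (sub_eq_zero.1 (norm_eq_zero.1 h0))
  have hu := Matrix.mulVec_injective_iff_isUnit.1 hinj
  rw [adjointState, map_neg, Matrix.toLpLin_apply, Matrix.toLpLin_apply,
    Matrix.mulVec_mulVec, Matrix.mul_nonsing_inv _ ((Matrix.isUnit_iff_isUnit_det _).1 hu),
    Matrix.one_mulVec]

theorem IsGame.lipOn_innerHess (hgame : IsGame μ Ω J g) (hμ : 0 < μ) (hL : 0 ≤ L)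
    (hLip : LipschitzData L Ω J g) [Nonempty (Fin n)] : LipOn (Set.univ.pi Ω) (innerHess g) :=
  LipOn.sum fun j _ => (hLip.lip_g22 j).lipOn_comp hL (hgame.lipOn_aggr hμ hL hLip)

theorem IsGame.lipOn_adjointState (hgame : IsGame μ Ω J g) (hμ : 0 < μ) (hL : 0 ≤ L)
    (hLip : LipschitzData L Ω J g) [Nonempty (Fin n)] (hΩ : Bornology.IsBounded (Set.univ.pi Ω))
    (i : Fin n) : LipOn (Set.univ.pi Ω) (adjointState J g i) ∧
      ∃ K, ∀ x ∈ Set.univ.pi Ω, ‖adjointState J g i x‖ ≤ K := by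
  have hσ := hgame.lipOn_aggr hμ hL hLip
  have hJ := (hLip.lip_J2 i).lipOn_comp hL hσ
  obtain ⟨K, hK⟩ := hJ.exists_bound hΩ
  have hz : ∀ x ∈ Set.univ.pi Ω, ‖adjointState J g i x‖ ≤ |K| / μ := by
    intro x hx
    have h := hgame.le_norm_innerHess hμ hx (adjointState J g i x)
    rw [hgame.innerHess_adjointState hμ hx, norm_neg] at h
    rw [le_div_iff₀ hμ, mul_comm]
    exact h.trans ((hK x hx).trans (le_abs_self _))
  refine ⟨?_, _, hz⟩
  obtain ⟨C, hC, hCJ⟩ := hJ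
  obtain ⟨D, hD, hDH⟩ := hgame.lipOn_innerHess hμ hL hLip
  refine ⟨(C + D * (|K| / μ)) / μ, by positivity, fun x hx x' hx' => ?_⟩
  have h := hgame.le_norm_innerHess hμ hx (adjointState J g i x - adjointState J g i x')
  have e : (innerHess g x).toEuclideanLin (adjointState J g i x - adjointState J g i x') =
      - (grad2 (J i) (x i) (aggr g x) - grad2 (J i) (x' i) (aggr g x'))
      - (innerHess g x - innerHess g x').toEuclideanLin (adjointState J g i x') := by
    rw [map_sub, hgame.innerHess_adjointState hμ hx, map_sub, LinearMap.sub_apply,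
      hgame.innerHess_adjointState hμ hx']
    abel
  rw [e] at h
  rw [div_mul_eq_mul_div, le_div_iff₀ hμ, mul_comm]
  refine h.trans ((norm_sub_le _ _).trans ?_)
  rw [norm_neg, add_mul]
  refine add_le_add (hCJ x hx x' hx') ((norm_toEuclideanLin_le _ _).trans ?_)
  calc _ ≤ (D * ‖x - x'‖) * (|K| / μ) := by
        gcongr
        · exact hDH x hx x' hx'
        · exact hz x' hx'
    _ = _ := by ring

theorem IsGame.lipOn_explicitGrad (hgame : IsGame μ Ω J g) (hμ : 0 < μ) (hL : 0 ≤ L)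
    (hLip : LipschitzData L Ω J g) [Nonempty (Fin n)] (hΩ : Bornology.IsBounded (Set.univ.pi Ω))
    (i : Fin n) : LipOn (Set.univ.pi Ω) fun x => explicitGrad J g x i := by
  have hσ := hgame.lipOn_aggr hμ hL hLip
  obtain ⟨hz, K, hK⟩ := hgame.lipOn_adjointState hμ hL hLip hΩ i
  have hM := (hLip.lip_g21 i).lipOn_comp hL hσ
  obtain ⟨K', hK'⟩ := hM.exists_bound hΩ
  exact ((hLip.lip_J1 i).lipOn_comp hL hσ).add (hM.toEuclideanLin hz hK' hK)

/-- Mean value estimate comparing an increment in the second argument with the derivative at a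
nearby base point. -/
theorem norm_sub_sub_le_of_fderiv {W : Type*} [NormedAddCommGroup W] [NormedSpace ℝ W]
    {f : E m₂ → W} {f' : E m₂ → E m₂ →L[ℝ] W} {D : E m₂ →L[ℝ] W} {y₀ y₁ : E m₂} {B e : ℝ}
    (hB : 0 ≤ B) (hf : ∀ y, HasFDerivAt f (f' y) y)
    (hD : ∀ y, ‖f' y - D‖ ≤ B * (e + ‖y - y₀‖)) :
    ‖f y₁ - f y₀ - D (y₁ - y₀)‖ ≤ B * (e + ‖y₁ - y₀‖) * ‖y₁ - y₀‖ := by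
  refine (convex_segment y₀ y₁).norm_image_sub_le_of_norm_hasFDerivWithin_le'
    (fun y _ => (hf y).hasFDerivWithinAt) (fun y hy => (hD y).trans ?_)
    (left_mem_segment ℝ _ _) (right_mem_segment ℝ _ _)
  gcongr
  obtain ⟨t, ht, rfl⟩ := (segment_eq_image' ℝ y₀ y₁) ▸ hy
  rw [add_sub_cancel_left, norm_smul, Real.norm_of_nonneg ht.1]
  exact mul_le_of_le_one_left (norm_nonneg _) ht.2

/-- The cost of a player as a function of the own action has derivative `explicitGrad` within the
action set. The derivative of the aggregation itself is not needed: the adjoint state, tested with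
the linearized optimality condition, replaces it. -/
theorem IsGame.hasFDerivWithinAt_ownCost (hgame : IsGame μ Ω J g) (hμ : 0 < μ) (hL : 0 ≤ L)
    (hLip : LipschitzData L Ω J g) [Nonempty (Fin n)] {x : Fin n → E m₁}
    (hx : x ∈ Set.univ.pi Ω) (i : Fin n) :
    HasFDerivWithinAt (ownCost J g i x) (innerSL ℝ (explicitGrad J g x i)) (Ω i) (x i) := by
  have hxi : x i ∈ Ω i := hx i trivial
  have hx' : ∀ u ∈ Ω i, Function.update x i u ∈ Set.univ.pi Ω := by
    intro u hu j _
    rcases eq_or_ne j i with rfl | hj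
    · simpa using hu
    · simpa [hj] using hx j trivial
  have hdiff : ∀ u j, ‖Function.update x i u j - x j‖ ≤ ‖u - x i‖ := by
    intro u j
    rcases eq_or_ne j i with rfl | hj
    · simp
    · simp [hj]
  set s : E m₁ → E m₂ := fun u => aggr g (Function.update x i u) with hs
  have hsi : s (x i) = aggr g x := by simp only [hs, Function.update_eq_self]
  set s₀ := aggr g x with hs₀
  obtain ⟨C, hC, hσ⟩ := hgame.lipOn_aggr hμ hL hLip
  have hsLip : ∀ u ∈ Ω i, ‖s u - s₀‖ ≤ C * ‖u - x i‖ := by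
    intro u hu
    refine (hσ _ (hx' u hu) _ hx).trans (mul_le_mul_of_nonneg_left ?_ hC)
    exact (pi_norm_le_iff_of_nonneg (norm_nonneg _)).2 fun j => hdiff u j
  set z := adjointState J g i x with hz
  set D := fderiv ℝ (fun u => grad2 (g i) u s₀) (x i) with hD
  -- second order remainders in the aggregated variable
  set r : Fin n → E m₁ → E m₂ := fun j u =>
    grad2 (g j) (Function.update x i u j) (s u) - grad2 (g j) (Function.update x i u j) s₀
      - (hess22 (g j) (x j) s₀).toEuclideanLin (s u - s₀) with hr
  set ρ : E m₁ → ℝ := fun u => J i u (s u) - J i u s₀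
      - inner ℝ (grad2 (J i) (x i) s₀) (s u - s₀) with hρ
  have hquad : ∀ u ∈ Ω i, L * (‖u - x i‖ + ‖s u - s₀‖) * ‖s u - s₀‖ ≤
      L * (1 + C) * C * ‖u - x i‖ ^ 2 := by
    intro u hu
    have h := hsLip u hu
    calc _ ≤ L * (‖u - x i‖ + C * ‖u - x i‖) * (C * ‖u - x i‖) := by gcongr
      _ = _ := by ring
  have hrO : ∀ j, (r j) =o[𝓝[Ω i] (x i)] fun u => u - x i := by
    intro j
    refine IsBigO.trans_isLittleO (IsBigO.of_bound (L * (1 + C) * C) ?_)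
      ((isLittleO_pow_sub_sub (x i) one_lt_two).mono nhdsWithin_le_nhds)
    filter_upwards [self_mem_nhdsWithin] with u hu
    have hj : Function.update x i u j ∈ Ω j := hx' u hu j trivial
    rw [norm_pow, norm_norm]
    refine le_trans ?_ (hquad u hu)
    simp only [hr]
    rw [hess22_apply]
    refine norm_sub_sub_le_of_fderiv hL (f := fun y => grad2 (g j) (Function.update x i u j) y)
      (fun y => (hgame.diff_g22 j _ hj y).hasFDerivAt) fun y => ?_
    refine (norm_fderiv_sub_le_hess22 _ _ _ _ _).trans ?_
    rw [mul_add]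
    refine (norm_sub_le_norm_sub_add_norm_sub _ (hess22 (g j) (x j) y) _).trans
      (add_le_add ?_ ((hLip.lip_g22 j).2 _ (hx j trivial) _ _))
    exact ((hLip.lip_g22 j).1 _ hj _ (hx j trivial) _).trans
      (mul_le_mul_of_nonneg_left (hdiff u j) hL)
  have hρO : ρ =o[𝓝[Ω i] (x i)] fun u => u - x i := by
    refine IsBigO.trans_isLittleO (IsBigO.of_bound (L * (1 + C) * C) ?_)
      ((isLittleO_pow_sub_sub (x i) one_lt_two).mono nhdsWithin_le_nhds)
    filter_upwards [self_mem_nhdsWithin] with u hu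
    rw [norm_pow, norm_norm]
    refine le_trans ?_ (hquad u hu)
    refine norm_sub_sub_le_of_fderiv (D := innerSL ℝ (grad2 (J i) (x i) s₀)) hL
      (f := fun y => J i u y) (f' := fun y => innerSL ℝ (grad2 (J i) u y))
      (fun y => (hgame.diff_J2 i _ hu y).hasGradientAt.hasFDerivAt) fun y => ?_
    rw [← map_sub, innerSL_apply_norm, mul_add]
    exact (norm_sub_le_norm_sub_add_norm_sub _ (grad2 (J i) (x i) y) _).trans
      (add_le_add ((hLip.lip_J2 i).1 _ hu _ hxi _) ((hLip.lip_J2 i).2 _ hxi _ _))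
  -- first order remainders in the own action
  set q : E m₁ → E m₂ := fun u => grad2 (g i) u s₀ - grad2 (g i) (x i) s₀ - D (u - x i) with hq
  set τ : E m₁ → ℝ := fun u => J i u s₀ - J i (x i) s₀ - inner ℝ (grad1 (J i) (x i) s₀) (u - x i)
    with hτ
  have hqO : q =o[𝓝[Ω i] (x i)] fun u => u - x i :=
    ((hasFDerivAt_iff_isLittleO.1 (hgame.diff_g21 i _ hxi s₀).hasFDerivAt)).mono nhdsWithin_le_nhds
  have hτO : τ =o[𝓝[Ω i] (x i)] fun u => u - x i :=
    ((hasFDerivAt_iff_isLittleO.1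
      (hgame.diff_J1 i _ hxi s₀).hasGradientAt.hasFDerivAt)).mono nhdsWithin_le_nhds
  have hzO : ∀ {w : E m₁ → E m₂}, w =o[𝓝[Ω i] (x i)] (fun u => u - x i) →
      (fun u => inner ℝ z (w u)) =o[𝓝[Ω i] (x i)] fun u => u - x i := fun {w} hw =>
    ((innerSL ℝ z).isBigO_comp w _).trans_isLittleO hw
  rw [hasFDerivWithinAt_iff_isLittleO]
  have htot := ((hρO.add hτO).add (hzO hqO)).add
    (hzO (IsLittleO.fun_sum fun j (_ : j ∈ Finset.univ) => hrO j))
  refine htot.congr' ?_ EventuallyEq.rfl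
  filter_upwards [self_mem_nhdsWithin] with u hu
  -- the linearized optimality condition
  have hlin : (innerHess g x).toEuclideanLin (s u - s₀) = - D (u - x i) - q u - ∑ j, r j u := by
    have h1 := hgame.sum_grad2_aggr hμ (hx' u hu)
    have h2 := hgame.sum_grad2_aggr hμ hx
    have h3 : ∑ j, (grad2 (g j) (Function.update x i u j) s₀ - grad2 (g j) (x j) s₀) =
        grad2 (g i) u s₀ - grad2 (g i) (x i) s₀ := by
      rw [Finset.sum_eq_single i]
      · simp
      · intro j _ hj; simp [hj]
      · intro h; exact absurd (Finset.mem_univ i) h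
    rw [Finset.sum_sub_distrib, h2, sub_zero] at h3
    simp only [hr, Finset.sum_sub_distrib]
    rw [h1, h3, innerHess, toEuclideanLin_sum]
    simp only [hq]
    abel
  have hsym : inner ℝ (grad2 (J i) (x i) s₀) (s u - s₀) =
      - inner ℝ z ((innerHess g x).toEuclideanLin (s u - s₀)) := by
    have h1 := hgame.innerHess_adjointState hμ hx i
    rw [← neg_neg (grad2 (J i) (x i) s₀), ← h1, inner_neg_left]
    congr 1
    rw [innerHess, toEuclideanLin_sum, toEuclideanLin_sum, sum_inner, inner_sum]
    exact Finset.sum_congr rfl fun j _ =>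
      hess22_symm (hgame.diff_g2 j _ (hx j trivial)) (hgame.diff_g22 j _ (hx j trivial) _) _ _
  rw [hlin] at hsym
  have hfin : inner ℝ (explicitGrad J g x i) (u - x i) =
      inner ℝ (grad1 (J i) (x i) s₀) (u - x i) + inner ℝ z (D (u - x i)) := by
    rw [explicitGrad, inner_add_left, inner_hess21]
  simp only [ownCost, Function.update_eq_self, innerSL_apply_apply, hfin]
  simp only [hρ, hτ]
  rw [hsym, inner_sub_right, inner_sub_right, inner_neg_right]
  ring

/-! ### Equilibria as solutions of a variational inequality -/

theorem IsGame.inner_pseudoGrad (hgame : IsGame μ Ω J g) (hμ : 0 < μ) (hL : 0 ≤ L)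
    (hLip : LipschitzData L Ω J g) [Nonempty (Fin n)] (hΩc : ∀ i, Convex ℝ (Ω i))
    {x : Fin n → E m₁} (hx : x ∈ Set.univ.pi Ω) (i : Fin n) {u : E m₁} (hu : u ∈ Ω i) :
    inner ℝ (pseudoGrad Ω J g x i) (u - x i) = inner ℝ (explicitGrad J g x i) (u - x i) := by
  have h1 := hgame.hasFDerivWithinAt_ownCost hμ hL hLip hx i
  have h2 := h1.differentiableWithinAt.hasFDerivWithinAt
  have hmem : u - x i ∈ tangentConeAt ℝ (Ω i) (x i) :=
    mem_tangentConeAt_of_segment_subset ((hΩc i).segment_subset (hx i trivial) hu)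
  have h3 := HasFDerivWithinAt.unique_on h2 h1 hmem
  rw [pseudoGrad, gradientWithin, InnerProductSpace.toDual_symm_apply]
  exact h3

theorem IsGame.explicitGrad_monotone (hgame : IsGame μ Ω J g) (hμ : 0 < μ) (hL : 0 ≤ L)
    (hLip : LipschitzData L Ω J g) [Nonempty (Fin n)] (hΩc : ∀ i, Convex ℝ (Ω i)) {θ : ℝ}
    (hmono : StronglyMonotone θ Ω (pseudoGrad Ω J g)) :
    StronglyMonotone θ Ω (explicitGrad J g) := by
  intro x hx x' hx'
  refine (hmono x hx x' hx').trans (le_of_eq (Finset.sum_congr rfl fun i _ => ?_))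
  rw [inner_sub_left, inner_sub_left, hgame.inner_pseudoGrad hμ hL hLip hΩc hx' i (hx i trivial),
    ← neg_sub (x' i) (x i), inner_neg_right, inner_neg_right, inner_neg_right,
    hgame.inner_pseudoGrad hμ hL hLip hΩc hx i (hx' i trivial)]

theorem IsGame.isStackelberg_iff (hgame : IsGame μ Ω J g) (hμ : 0 < μ) (hL : 0 ≤ L)
    (hLip : LipschitzData L Ω J g) [Nonempty (Fin n)] (hΩc : ∀ i, Convex ℝ (Ω i))
    {x : Fin n → E m₁} {y : E m₂} :
    IsStackelberg Ω J g x y ↔ (x ∈ Set.univ.pi Ω ∧ y = aggr g x ∧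
      ∀ i, ∀ u ∈ Ω i, 0 ≤ inner ℝ (explicitGrad J g x i) (u - x i)) := by
  constructor
  · rintro ⟨hx, hmin, hy⟩
    refine ⟨hx, hgame.eq_aggr hμ hx hy, fun i u hu => ?_⟩
    have h1 := hgame.hasFDerivWithinAt_ownCost hμ hL hLip hx i
    have h2 : IsLocalMinOn (ownCost J g i x) (Ω i) (x i) := by
      refine IsMinOn.localize fun u hu => ?_
      have := hmin i u hu
      simpa [ownCost] using this
    exact h2.hasFDerivWithinAt_nonneg h1
      (sub_mem_posTangentConeAt_of_segment_subset ((hΩc i).segment_subset (hx i trivial) hu))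
  · rintro ⟨hx, rfl, hvi⟩
    refine ⟨hx, fun i u hu => ?_, hgame.isInnerMin_aggr hμ hx⟩
    have hxi : x i ∈ Ω i := hx i trivial
    have h1 := hgame.hasFDerivWithinAt_ownCost hμ hL hLip hx i
    have hline : HasDerivAt (fun t : ℝ => x i + t • (u - x i)) (u - x i) 0 := by
      simpa using ((hasDerivAt_id (0 : ℝ)).smul_const (u - x i)).const_add (x i)
    have h2 : HasDerivWithinAt (fun t : ℝ => ownCost J g i x (x i + t • (u - x i)))
        (inner ℝ (explicitGrad J g x i) (u - x i)) (Set.Icc 0 1) 0 := by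
      have h3 : HasFDerivWithinAt (ownCost J g i x) (innerSL ℝ (explicitGrad J g x i)) (Ω i)
          (x i + (0 : ℝ) • (u - x i)) := by simpa using h1
      exact h3.comp_hasDerivWithinAt 0 hline.hasDerivWithinAt fun t ht =>
        (hΩc i).add_smul_sub_mem hxi hu ht
    have h3 := deriv_le_of_chord (c := 0) ((h2.mono Set.Ioo_subset_Icc_self).mono_of_mem_nhdsWithin
      (Ioo_mem_nhdsGT one_pos)) ?_
    · have h4 := hvi i u hu
      simp only [one_smul, zero_smul, add_zero, add_sub_cancel, ownCost,
        Function.update_eq_self] at h3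
      linarith
    · intro t ht
      have h5 := (hgame.convex_cost i x hx).2 hxi hu (sub_nonneg.2 ht.2.le) ht.1.le
        (sub_add_cancel 1 t)
      rw [show x i + t • (u - x i) = (1 - t) • x i + t • u by module]
      simpa using h5

end Game

/-! ### Projections and profiles -/

section Profiles

variable {n m : ℕ}

theorem isConvexProj_proj {S : Set (E m)} (hne : S.Nonempty) (hc : Convex ℝ S) (hS : IsCompact S) :
    IsConvexProj S (proj S) := by
  intro w
  have hex : ∃ p, p ∈ S ∧ ∀ q ∈ S, ‖p - w‖ ≤ ‖q - w‖ :=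
    hS.exists_isMinOn hne (f := fun p => ‖p - w‖) (by fun_prop)
  obtain ⟨h1, h2⟩ : proj S w ∈ S ∧ ∀ q ∈ S, ‖proj S w - w‖ ≤ ‖q - w‖ := Classical.epsilon_spec hex
  refine ⟨h1, (norm_eq_iInf_iff_real_inner_le_zero hc h1).1 ?_⟩
  have : Nonempty S := hne.to_subtype
  refine le_antisymm (le_ciInf fun q => ?_) ?_
  · rw [norm_sub_rev w, norm_sub_rev w]; exact h2 q q.2
  · exact ciInf_le (f := fun q : S => ‖w - q‖) ⟨0, by rintro _ ⟨q, rfl⟩; exact norm_nonneg _⟩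
      ⟨proj S w, h1⟩

/-- The product `∏ Ω i` as a set of profiles. -/
def profileSet (Ω : Fin n → Set (E m)) : Set (Profile n m) := {X | ∀ i, X i ∈ Ω i}

theorem isCompact_profileSet {Ω : Fin n → Set (E m)} (hΩ : ∀ i, IsCompact (Ω i)) :
    IsCompact (profileSet Ω) := by
  have h := (isCompact_univ_pi hΩ).image (PiLp.continuous_toLp 2 fun _ : Fin n => E m)
  convert h using 1
  ext X
  constructor
  · exact fun hX => ⟨WithLp.ofLp X, fun i _ => hX i, rfl⟩
  · rintro ⟨Y, hY, rfl⟩ i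
    exact hY i trivial

theorem convex_profileSet {Ω : Fin n → Set (E m)} (hΩ : ∀ i, Convex ℝ (Ω i)) :
    Convex ℝ (profileSet Ω) :=
  fun _ hX _ hY _ _ ha hb hab i => hΩ i (hX i) (hY i) ha hb hab

theorem Profile.inner_eq (u w : Profile n m) : inner ℝ u w = ∑ i, inner ℝ (u i) (w i) :=
  PiLp.inner_apply u w

theorem Profile.norm_sq_eq_sum (u : Profile n m) : ‖u‖ ^ 2 = ∑ i, ‖u i‖ ^ 2 :=
  PiLp.norm_sq_eq_of_L2 _ u

theorem Profile.norm_le_sum (u : Profile n m) : ‖u‖ ≤ ∑ i, ‖u i‖ := by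
  refine le_of_sq_le_sq ?_ (by positivity)
  rw [Profile.norm_sq_eq_sum]
  exact Finset.sum_sq_le_sq_sum_of_nonneg (f := fun i => ‖u i‖) fun i _ => norm_nonneg _

theorem Profile.pi_norm_le (u : Profile n m) : ‖WithLp.ofLp u‖ ≤ ‖u‖ :=
  (pi_norm_le_iff_of_nonneg (norm_nonneg _)).2 fun i => PiLp.norm_apply_le u i

theorem isBigO_profile {f : ℕ → Profile n m} {η : ℕ → ℝ}
    (hf : ∀ i, (fun t => f t i) =O[atTop] η) : f =O[atTop] η := by
  refine IsBigO.trans (IsBigO.of_bound 1 (Eventually.of_forall fun t => ?_))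
    (IsBigO.fun_sum fun i (_ : i ∈ Finset.univ) => (hf i).norm_left)
  rw [one_mul]
  exact (Profile.norm_le_sum _).trans (le_abs_self _)

theorem isConvexProj_profile {Ω : Fin n → Set (E m)} {P : Fin n → E m → E m}
    (hP : ∀ i, IsConvexProj (Ω i) (P i)) :
    IsConvexProj (profileSet Ω) fun w => (WithLp.toLp 2 fun i => P i (w i) : Profile n m) := by
  intro w
  refine ⟨fun i => (hP i (w i)).1, fun q hq => ?_⟩
  rw [Profile.inner_eq]
  exact Finset.sum_nonpos fun i _ => (hP i (w i)).2 _ (hq i)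

end Profiles

/-! ### Tracking along a run of the algorithm -/

section Run

theorem LipOn.isBigO_comp {X W : Type*} [NormedAddCommGroup X] [NormedAddCommGroup W] {S : Set X}
    {f : X → W} (hf : LipOn S f) {x x' : ℕ → X} (hx : ∀ t, x t ∈ S) (hx' : ∀ t, x' t ∈ S) :
    (fun t => f (x t) - f (x' t)) =O[atTop] fun t => x t - x' t := by
  obtain ⟨C, -, h⟩ := hf
  exact IsBigO.of_bound C (Eventually.of_forall fun t => h _ (hx t) _ (hx' t))

theorem isBigO_shift {η : ℕ → ℝ} (hlim : Tendsto (fun t => η (t + 1) / η t) atTop (𝓝 1))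
    (hη : ∀ t, 0 < η t) {W : Type*} [NormedAddCommGroup W] {f : ℕ → W} (hf : f =O[atTop] η) :
    (fun t => f (t + 1)) =O[atTop] η := by
  refine (hf.comp_tendsto (tendsto_add_atTop_nat 1)).trans ?_
  refine IsBigO.of_bound 2 ?_
  filter_upwards [hlim.eventually (gt_mem_nhds one_lt_two)] with t ht
  rw [div_lt_iff₀ (hη t)] at ht
  rw [Function.comp_apply, Real.norm_of_nonneg (hη _).le, Real.norm_of_nonneg (hη t).le]
  exact ht.le

theorem sqrt_contraction {u w c : ℝ} (hu : 0 ≤ u) (h : w ^ 2 ≤ c * u ^ 2) : w ≤ √c * u := by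
  calc w ≤ |w| := le_abs_self w
    _ = √(w ^ 2) := (Real.sqrt_sq_eq_abs w).symm
    _ ≤ √(c * u ^ 2) := Real.sqrt_le_sqrt h
    _ = √c * u := by rw [Real.sqrt_mul' _ (sq_nonneg u), Real.sqrt_sq hu]

variable {n m₁ m₂ : ℕ} {μ L : ℝ} {Ω : Fin n → Set (E m₁)} {J g : Fin n → E m₁ → E m₂ → ℝ}
  {A : Matrix (Fin n) (Fin n) ℝ} {κ α k : ℝ} {η : ℕ → ℝ}
  {x : ℕ → Fin n → E m₁} {y lam : ℕ → Fin n → E m₂}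
  {v : ℕ → Fin n → Matrix (Fin m₂) (Fin m₂) ℝ} {z : ℕ → Fin n → E m₂}

theorem IsRun.mem (hrun : IsRun Ω J g A κ α k η x y lam v z)
    (hP : ∀ i, IsConvexProj (Ω i) (proj (Ω i))) (hΩc : ∀ i, Convex ℝ (Ω i))
    (hη0 : ∀ t, 0 < η t) (hη1 : ∀ t, η t ≤ 1) (t : ℕ) : x t ∈ Set.univ.pi Ω := by
  induction t with
  | zero => exact fun i _ => hrun.x_zero i
  | succ t ih =>
    intro i _
    rw [hrun.x_succ]
    exact hΩc i (ih i trivial) (hP i _).1 (sub_nonneg.2 (hη1 t)) (hη0 t).le (sub_add_cancel _ _)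

theorem IsRun.x_increment (hrun : IsRun Ω J g A κ α k η x y lam v z)
    (hP : ∀ i, IsConvexProj (Ω i) (proj (Ω i))) (hΩb : ∀ i, Bornology.IsBounded (Ω i))
    (hx : ∀ t, x t ∈ Set.univ.pi Ω) : (fun t => x (t + 1) - x t) =O[atTop] η := by
  refine isBigO_pi.2 fun i => ?_
  obtain ⟨D, hD⟩ := Metric.isBounded_iff.1 (hΩb i)
  refine IsBigO.of_bound D (Eventually.of_forall fun t => ?_)
  rw [Pi.sub_apply, hrun.x_succ]
  set p := proj (Ω i) (x t i - k • (grad1 (J i) (x t i) (y t i) +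
    (hess21 (g i) (x t i) (y t i)).toEuclideanLin (z t i))) with hp
  have hpm : p ∈ Ω i := (hP i _).1
  have e : (1 - η t) • x t i + η t • p - x t i = η t • (p - x t i) := by module
  rw [e, norm_smul, mul_comm]
  refine mul_le_mul_of_nonneg_right ?_ (norm_nonneg _)
  rw [← dist_eq_norm]
  exact hD hpm (hx t i trivial)

/-- The estimates of the aggregation converge at the order of the step size: for frozen actions the
primal-dual iteration contracts towards its saddle point, which is Lipschitz in the actions. -/
theorem IsRun.y_tracking (hrun : IsRun Ω J g A κ α k η x y lam v z)
    (hgame : IsGame μ Ω J g) (hμ : 0 < μ) (hL : 0 < L) (hLip : LipschitzData L Ω J g)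
    (hA : IsNetwork A) (hκ : 0 < κ) (hκL : κ * L < 1)
    (hκμ : ∀ l ∈ spectrum ℝ (1 - A), κ * l ^ 2 < μ)
    (hη : ∀ t, 0 < η t) (hlim : Tendsto (fun t => η (t + 1) / η t) atTop (𝓝 1))
    (hx : ∀ t, x t ∈ Set.univ.pi Ω) (hinc : (fun t => x (t + 1) - x t) =O[atTop] η) (i : Fin n) :
    (fun t => y t i - aggr g (x t)) =O[atTop] η := by
  have := hA.nonempty
  obtain ⟨⟨c, hc, hlow⟩, hup⟩ := hA.exists_lap_bounds m₂
  obtain ⟨μ', hμ', hup⟩ := hup κ μ hκμ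
  have hσ := hgame.lipOn_aggr hμ hL.le hLip
  -- the saddle point at a given action profile
  set Ys : (Fin n → E m₁) → Profile n m₂ := fun X => WithLp.toLp 2 fun _ => aggr g X with hYs
  set Γ : (Fin n → E m₁) → Profile n m₂ → Profile n m₂ := fun X Y =>
    WithLp.toLp 2 fun i => grad2 (g i) (X i) (Y i) with hΓ
  have hdual : ∀ X : Fin n → E m₁, ∃ l : Profile n m₂, X ∈ Set.univ.pi Ω →
      ∑ i, l i = 0 ∧ lap A l = - Γ X (Ys X) := by
    intro X
    by_cases hX : X ∈ Set.univ.pi Ω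
    · obtain ⟨l, h1, h2⟩ := hA.exists_lap_eq (- Γ X (Ys X)) (by
        have h := hgame.sum_grad2_aggr hμ hX
        simp only [PiLp.neg_apply, Finset.sum_neg_distrib, neg_eq_zero]
        exact h)
      exact ⟨l, fun _ => ⟨h1, h2⟩⟩
    · exact ⟨0, fun h => absurd h hX⟩
  choose Ls hLs using hdual
  have hYsinc : (fun t => Ys (x (t + 1)) - Ys (x t)) =O[atTop] η :=
    isBigO_profile fun i => (hσ.isBigO_comp (fun t => hx (t + 1)) hx).trans hinc
  have hΓinc : (fun t => Γ (x (t + 1)) (Ys (x (t + 1))) - Γ (x t) (Ys (x t))) =O[atTop] η :=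
    isBigO_profile fun i => (((hLip.lip_g2 i).lipOn_comp hL.le hσ).isBigO_comp
      (fun t => hx (t + 1)) hx).trans hinc
  have hLsinc : (fun t => Ls (x (t + 1)) - Ls (x t)) =O[atTop] η := by
    refine (IsBigO.of_bound c⁻¹ (Eventually.of_forall fun t => ?_)).trans hΓinc
    obtain ⟨h1, h2⟩ := hLs _ (hx (t + 1))
    obtain ⟨h3, h4⟩ := hLs _ (hx t)
    have h5 := hlow (Ls (x (t + 1)) - Ls (x t)) (by
      simp only [PiLp.sub_apply, Finset.sum_sub_distrib, h1, h3, sub_self])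
    rw [map_sub, h2, h4, ← neg_sub', norm_neg] at h5
    rw [← div_eq_inv_mul, le_div_iff₀ hc, mul_comm]
    exact h5
  -- the iterates
  set Y : ℕ → Profile n m₂ := fun t => WithLp.toLp 2 (y t) with hY
  set Λ : ℕ → Profile n m₂ := fun t => WithLp.toLp 2 (lam t) with hΛ
  have hYrec : ∀ t, Y (t + 1) = Y t + κ • (- lap A (Λ t) - Γ (x t) (Y t)) := by
    intro t
    ext1 i
    have h := hrun.y_succ t i
    simp only [hY, hΛ, hΓ, PiLp.add_apply, PiLp.smul_apply, PiLp.sub_apply, PiLp.neg_apply,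
      lap_apply]
    rw [h, neg_sub]
  have hΛrec : ∀ t, Λ (t + 1) = Λ t + κ • lap A (Y (t + 1)) := by
    intro t
    ext1 i
    have h := hrun.lam_succ t i
    simp only [hY, hΛ, PiLp.add_apply, PiLp.smul_apply, lap_apply]
    rw [h, ← neg_sub (∑ j, A i j • y (t + 1) j), smul_neg, sub_eq_add_neg]
  have hΛsum : ∀ t, ∑ i, Λ t i = 0 := by
    intro t
    induction t with
    | zero => exact Finset.sum_eq_zero fun i _ => hrun.lam_zero i
    | succ t ih =>
      rw [hΛrec]
      simp only [PiLp.add_apply, PiLp.smul_apply, Finset.sum_add_distrib, ← Finset.smul_sum,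
        hA.sum_lap, ih, smul_zero, add_zero]
  obtain ⟨ε, hε0, hε1, hε2⟩ : ∃ ε : ℝ, 0 < ε ∧ ε * (c ^ 2 + 2 * L ^ 2) ≤ κ * μ * c ^ 2 ∧
      2 * ε ≤ (1 - κ * L) * (c ^ 2 * κ ^ 2) := by
    have h1 : 0 < 1 - κ * L := by linarith
    refine ⟨min (κ * μ * c ^ 2 / (c ^ 2 + 2 * L ^ 2)) ((1 - κ * L) * (c ^ 2 * κ ^ 2) / 2),
      lt_min (by positivity) (by positivity), ?_, ?_⟩
    · rw [← le_div_iff₀ (by positivity)]; exact min_le_left _ _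
    · have := min_le_right (κ * μ * c ^ 2 / (c ^ 2 + 2 * L ^ 2))
        ((1 - κ * L) * (c ^ 2 * κ ^ 2) / 2)
      linarith
  have hstep : ∀ t, ‖Y (t + 1) - Ys (x t)‖ ^ 2 + ‖Λ (t + 1) - Ls (x t)‖ ^ 2 ≤
      (1 - ε) * (‖Y t - Ys (x t)‖ ^ 2 + ‖Λ t - Ls (x t)‖ ^ 2) := by
    intro t
    obtain ⟨h1, h2⟩ := hLs _ (hx t)
    refine primalDual_step (lap A) hA.lap_isSymmetric hκ hμ'.le hε0.le hc hε1 hε2 (hYrec t)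
      (hΛrec t) (hA.lap_const _) h2 ?_ ?_ (hup _) (hlow _ ?_)
    · simp only [Profile.norm_sq_eq_sum, Profile.inner_eq, ← Finset.sum_add_distrib,
        Finset.mul_sum, ← Finset.sum_sub_distrib]
      exact Finset.sum_le_sum fun i _ => StrongConvexOn.three_point
        (hgame.strong i _ (hx t i trivial)) (hgame.hasGradientAt_inner (hx t i trivial))
        (fun y y' => (hLip.lip_g2 i).2 _ (hx t i trivial) y y') _ _ _
    · refine le_of_sq_le_sq ?_ (by positivity)
      rw [mul_pow, Profile.norm_sq_eq_sum, Profile.norm_sq_eq_sum, Finset.mul_sum]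
      refine Finset.sum_le_sum fun i _ => ?_
      rw [← mul_pow]
      exact pow_le_pow_left₀ (norm_nonneg _) ((hLip.lip_g2 i).2 _ (hx t i trivial) _ _) 2
    · simp only [PiLp.sub_apply, Finset.sum_sub_distrib, h1, hΛsum, sub_self]
  -- distance to the saddle point in the product space
  set Q : ℕ → WithLp 2 (Profile n m₂ × Profile n m₂) := fun t =>
    WithLp.toLp 2 (Ys (x t), Ls (x t)) with hQ
  set R : ℕ → WithLp 2 (Profile n m₂ × Profile n m₂) := fun t => WithLp.toLp 2 (Y t, Λ t) with hR
  have hnorm : ∀ s t, ‖R s - Q t‖ ^ 2 = ‖Y s - Ys (x t)‖ ^ 2 + ‖Λ s - Ls (x t)‖ ^ 2 :=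
    fun s t => WithLp.prod_norm_sq_eq_of_L2 _
  have hQinc : (fun t => Q (t + 1) - Q t) =O[atTop] η := by
    refine (IsBigO.of_bound 1 (Eventually.of_forall fun t => ?_)).trans
      (hYsinc.norm_left.add hLsinc.norm_left)
    rw [one_mul]
    refine le_trans ?_ (le_abs_self _)
    refine le_of_sq_le_sq ?_ (by positivity)
    rw [WithLp.prod_norm_sq_eq_of_L2]
    change ‖Ys (x (t + 1)) - Ys (x t)‖ ^ 2 + ‖Ls (x (t + 1)) - Ls (x t)‖ ^ 2 ≤ _
    nlinarith [norm_nonneg (Ys (x (t + 1)) - Ys (x t)), norm_nonneg (Ls (x (t + 1)) - Ls (x t))]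
  have hmain : (fun t => ‖R t - Q t‖) =O[atTop] η := by
    refine isBigO_of_contraction (ρ := √(1 - ε)) ?_ hη hlim (fun t => norm_nonneg _)
      hQinc.norm_left (Eventually.of_forall fun t => ?_) (Real.sqrt_nonneg _)
    · rw [Real.sqrt_lt' one_pos]; linarith
    · have h1 : ‖R (t + 1) - Q t‖ ≤ √(1 - ε) * ‖R t - Q t‖ := by
        refine sqrt_contraction (norm_nonneg _) ?_
        rw [hnorm, hnorm]
        exact hstep t
      have h2 : ‖R (t + 1) - Q (t + 1)‖ ≤ ‖R (t + 1) - Q t‖ + ‖Q t - Q (t + 1)‖ :=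
        norm_sub_le_norm_sub_add_norm_sub _ _ _
      rw [norm_sub_rev (Q t)] at h2
      linarith
  refine (IsBigO.of_bound 1 (Eventually.of_forall fun t => ?_)).trans hmain
  rw [one_mul, norm_norm]
  have h1 : ‖y t i - aggr g (x t)‖ ≤ ‖Y t - Ys (x t)‖ := PiLp.norm_apply_le (Y t - Ys (x t)) i
  refine h1.trans (le_of_sq_le_sq ?_ (norm_nonneg _))
  rw [hnorm]
  exact le_add_of_nonneg_right (sq_nonneg _)

theorem LipschitzEach.isBigO_increment {W : Type*} [NormedAddCommGroup W] {f : E m₁ → E m₂ → W}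
    {i : Fin n} (hf : LipschitzEach L (Ω i) f) {x x' : ℕ → Fin n → E m₁}
    {y y' : ℕ → E m₂} (hx : ∀ t, x t ∈ Set.univ.pi Ω) (hx' : ∀ t, x' t ∈ Set.univ.pi Ω)
    (hxx : (fun t => x t - x' t) =O[atTop] η) (hyy : (fun t => y t - y' t) =O[atTop] η) :
    (fun t => f (x t i) (y t) - f (x' t i) (y' t)) =O[atTop] η := by
  have h1 : (fun t => f (x t i) (y t) - f (x' t i) (y t)) =O[atTop] η :=
    (IsBigO.of_bound L (Eventually.of_forall fun t =>
      hf.1 _ (hx t i trivial) _ (hx' t i trivial) _)).trans (isBigO_pi.1 hxx i)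
  have h2 : (fun t => f (x' t i) (y t) - f (x' t i) (y' t)) =O[atTop] η :=
    (IsBigO.of_bound L (Eventually.of_forall fun t => hf.2 _ (hx' t i trivial) _ _)).trans hyy
  refine (h1.add h2).congr_left fun t => ?_
  abel

/-- The trackers `n v_i` follow the sum of the Hessians at the current iterates. -/
theorem IsRun.v_tracking (hrun : IsRun Ω J g A κ α k η x y lam v z) (hLip : LipschitzData L Ω J g)
    (hA : IsNetwork A) (hη : ∀ t, 0 < η t)
    (hlim : Tendsto (fun t => η (t + 1) / η t) atTop (𝓝 1)) (hx : ∀ t, x t ∈ Set.univ.pi Ω)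
    (hinc : (fun t => x (t + 1) - x t) =O[atTop] η)
    (hyinc : ∀ i, (fun t => y (t + 1) i - y t i) =O[atTop] η) (i : Fin n) :
    (fun t => (n : ℝ) • v t i - ∑ j, hess22 (g j) (x t j) (y t j)) =O[atTop] η := by
  have hentry : ∀ p q, (fun t => n * v t i p q - ∑ j, hess22 (g j) (x t j) (y t j) p q)
      =O[atTop] η := by
    intro p q
    refine hA.tracking_isBigO (u := fun t i => v t i p q)
      (h := fun t i => hess22 (g i) (x t i) (y t i) p q) hη hlim (fun i => ?_) (fun t i => ?_)
      (fun i => ?_) i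
    · rw [hrun.v_zero]
    · rw [hrun.v_succ]
      simp [Matrix.sum_apply]
    · refine (IsBigO.of_bound 1 (Eventually.of_forall fun t => ?_)).trans
        ((hLip.lip_g22 i).isBigO_increment (fun t => hx (t + 1)) hx hinc (hyinc i))
      rw [one_mul, ← Matrix.sub_apply]
      exact abs_entry_le_norm _ p q
  refine (IsBigO.of_bound 1 (Eventually.of_forall fun t => ?_)).trans
    (IsBigO.fun_sum fun p (_ : p ∈ Finset.univ) => IsBigO.fun_sum fun q (_ : q ∈ Finset.univ) =>
      (hentry p q).norm_left)
  rw [one_mul]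
  refine (frobenius_norm_le_sum _).trans (le_trans (le_of_eq ?_) (le_abs_self _))
  simp [Matrix.sum_apply, Matrix.sub_apply]

theorem isBigO_toEuclideanLin {p q : ℕ} {M : ℕ → Matrix (Fin p) (Fin q) ℝ} {w : ℕ → E q} {K : ℝ}
    (hM : M =O[atTop] η) (hw : ∀ t, ‖w t‖ ≤ K) :
    (fun t => (M t).toEuclideanLin (w t)) =O[atTop] η := by
  refine (IsBigO.of_bound K (Eventually.of_forall fun t => ?_)).trans hM
  rw [mul_comm]
  exact (norm_toEuclideanLin_le _ _).trans (mul_le_mul_of_nonneg_left (hw t) (norm_nonneg _))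

/-- The sequences `z_i` follow the adjoint states. The bound on `α` makes `1 - α H` a contraction
for every sum `H` of Hessians at the iterates, by coercivity and boundedness alone. -/
theorem IsRun.z_tracking (hrun : IsRun Ω J g A κ α k η x y lam v z)
    (hgame : IsGame μ Ω J g) (hμ : 0 < μ) (hL : 0 < L) (hLip : LipschitzData L Ω J g)
    [Nonempty (Fin n)] (hΩb : Bornology.IsBounded (Set.univ.pi Ω)) {K₀ : ℝ} (hK₀pos : 0 < K₀)
    (hK₀ : ∀ t i, ‖hess22 (g i) (x t i) (y t i)‖ ≤ K₀)
    (hα : 0 < α) (hαK : α < μ / (2 * n * K₀ ^ 2))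
    (hη : ∀ t, 0 < η t) (hlim : Tendsto (fun t => η (t + 1) / η t) atTop (𝓝 1))
    (hη0 : Tendsto η atTop (𝓝 0)) (hx : ∀ t, x t ∈ Set.univ.pi Ω)
    (hinc : (fun t => x (t + 1) - x t) =O[atTop] η)
    (hy : ∀ i, (fun t => y t i - aggr g (x t)) =O[atTop] η)
    (hv : ∀ i, (fun t => (n : ℝ) • v t i - ∑ j, hess22 (g j) (x t j) (y t j)) =O[atTop] η)
    (i : Fin n) : (fun t => z t i - adjointState J g i (x t)) =O[atTop] η := by
  have hn : (1 : ℝ) ≤ n := by exact_mod_cast Fin.pos_iff_nonempty.2 ‹_›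
  obtain ⟨hzlip, K, hK⟩ := hgame.lipOn_adjointState hμ hL.le hLip hΩb i
  set ζ : ℕ → E m₂ := fun t => adjointState J g i (x t) with hζ
  set H : ℕ → Matrix (Fin m₂) (Fin m₂) ℝ := fun t => ∑ j, hess22 (g j) (x t j) (y t j) with hH
  set R : ℕ → Matrix (Fin m₂) (Fin m₂) ℝ := fun t => (n : ℝ) • v t i - H t with hR
  set e : ℕ → E m₂ := fun t => z t i - ζ t with he
  have hζK : ∀ t, ‖ζ t‖ ≤ K := fun t => hK _ (hx t)
  have hxx : (fun t => x t - x t) =O[atTop] η := by simpa using isBigO_zero η atTop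
  have hS : (fun t => H t - innerHess g (x t)) =O[atTop] η := by
    simp only [hH, innerHess, ← Finset.sum_sub_distrib]
    exact IsBigO.fun_sum fun j _ => (hLip.lip_g22 j).isBigO_increment hx hx hxx (hy j)
  have hγ : (fun t => grad2 (J i) (x t i) (y t i) - grad2 (J i) (x t i) (aggr g (x t)))
      =O[atTop] η := (hLip.lip_J2 i).isBigO_increment hx hx hxx (hy i)
  have hζinc : (fun t => ζ (t + 1) - ζ t) =O[atTop] η :=
    (hzlip.isBigO_comp (fun t => hx (t + 1)) hx).trans hinc
  set w : ℕ → E m₂ := fun t => α • ((R t).toEuclideanLin (ζ t)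
    + (H t - innerHess g (x t)).toEuclideanLin (ζ t)
    + (grad2 (J i) (x t i) (y t i) - grad2 (J i) (x t i) (aggr g (x t))))
    + (ζ (t + 1) - ζ t) with hw
  have hwO : w =O[atTop] η :=
    ((((isBigO_toEuclideanLin (hv i) hζK).add (isBigO_toEuclideanLin hS hζK)).add hγ).const_smul_left
      α).add hζinc
  have hrec : ∀ t, e (t + 1) = (e t - α • (H t).toEuclideanLin (e t))
      - α • (R t).toEuclideanLin (e t) - w t := by
    intro t
    have h1 := hrun.z_succ t i
    have h2 := hgame.innerHess_adjointState hμ (hx t) i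
    have h3 : (n : ℝ) • (v t i).toEuclideanLin (z t i) =
        (H t).toEuclideanLin (e t) + (H t).toEuclideanLin (ζ t) + (R t).toEuclideanLin (e t)
        + (R t).toEuclideanLin (ζ t) := by
      have e1 : (n : ℝ) • v t i = H t + R t := (add_sub_cancel _ _).symm
      have e2 : z t i = e t + ζ t := (sub_add_cancel _ _).symm
      rw [← LinearMap.smul_apply, ← map_smul, e1, e2]
      simp only [map_add, LinearMap.add_apply]
      abel
    have h4 : grad2 (J i) (x t i) (aggr g (x t)) = - (innerHess g (x t)).toEuclideanLin (ζ t) := by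
      rw [h2, neg_neg]
    simp only [hw]
    rw [h4, map_sub Matrix.toEuclideanLin (H t), LinearMap.sub_apply]
    simp only [he] at h3 ⊢
    rw [h1, h3]
    module
  have hHbound : ∀ t u, ‖(H t).toEuclideanLin u‖ ≤ n * K₀ * ‖u‖ := by
    intro t u
    refine (norm_toEuclideanLin_le _ _).trans (mul_le_mul_of_nonneg_right ?_ (norm_nonneg _))
    refine (norm_sum_le_of_le _ fun j _ => hK₀ t j).trans (le_of_eq ?_)
    rw [Finset.sum_const, Finset.card_univ, Fintype.card_fin, nsmul_eq_mul]
  have hαK' : α * (n * K₀ ^ 2) ≤ μ / 2 := by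
    have h : α * (2 * n * K₀ ^ 2) < μ := by rwa [lt_div_iff₀ (by positivity)] at hαK
    linarith
  set q := √(1 - α * (n * μ)) with hq
  have hq1 : q < 1 := by
    rw [hq, Real.sqrt_lt' one_pos]
    have : 0 < α * (n * μ) := by positivity
    linarith
  have hcontr : ∀ t u, ‖u - α • (H t).toEuclideanLin u‖ ≤ q * ‖u‖ := by
    intro t u
    refine sqrt_contraction (norm_nonneg _) ?_
    rw [norm_sub_sq_real, inner_smul_right, norm_smul, Real.norm_of_nonneg hα.le, real_inner_comm]
    have h1 := mul_le_mul_of_nonneg_left (hgame.sum_hess22_coercive (hx t) (y t) u) hα.le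
    have h2 : (α * ‖(H t).toEuclideanLin u‖) ^ 2 ≤ α * (n * (μ / 2)) * ‖u‖ ^ 2 := by
      have h3 := pow_le_pow_left₀ (norm_nonneg _) (hHbound t u) 2
      have h4 := mul_le_mul_of_nonneg_left hαK' (show 0 ≤ α * n * ‖u‖ ^ 2 by positivity)
      have h5 := mul_le_mul_of_nonneg_left h3 (sq_nonneg α)
      calc _ = α ^ 2 * ‖(H t).toEuclideanLin u‖ ^ 2 := by ring
        _ ≤ α ^ 2 * (n * K₀ * ‖u‖) ^ 2 := h5
        _ = α * n * ‖u‖ ^ 2 * (α * (n * K₀ ^ 2)) := by ring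
        _ ≤ _ := h4
        _ = _ := by ring
    have h6 : 0 ≤ α * (n * μ) * ‖u‖ ^ 2 := by positivity
    linarith
  have hRsmall : ∀ᶠ t in atTop, α * ‖R t‖ < (1 - q) / 2 := by
    have h1 : Tendsto (fun t => α * ‖R t‖) atTop (𝓝 (α * ‖(0 : Matrix (Fin m₂) (Fin m₂) ℝ)‖)) :=
      ((hv i).trans_tendsto hη0).norm.const_mul α
    rw [norm_zero, mul_zero] at h1
    exact h1.eventually (gt_mem_nhds (by linarith))
  have hmain : (fun t => ‖e t‖) =O[atTop] η := by
    refine isBigO_of_contraction (ρ := (1 + q) / 2) (by linarith) hη hlim (fun t => norm_nonneg _)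
      hwO.norm_left ?_ (by have := Real.sqrt_nonneg (1 - α * (n * μ)); linarith)
    filter_upwards [hRsmall] with t ht
    rw [hrec]
    have h1 := hcontr t (e t)
    have h2 : ‖α • (R t).toEuclideanLin (e t)‖ ≤ (1 - q) / 2 * ‖e t‖ := by
      rw [norm_smul, Real.norm_of_nonneg hα.le]
      calc _ ≤ α * (‖R t‖ * ‖e t‖) :=
            mul_le_mul_of_nonneg_left (norm_toEuclideanLin_le _ _) hα.le
        _ = α * ‖R t‖ * ‖e t‖ := by ring
        _ ≤ _ := mul_le_mul_of_nonneg_right ht.le (norm_nonneg _)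
    have h3 := norm_sub_le (e t - α • (H t).toEuclideanLin (e t)
      - α • (R t).toEuclideanLin (e t)) (w t)
    have h4 := norm_sub_le (e t - α • (H t).toEuclideanLin (e t)) (α • (R t).toEuclideanLin (e t))
    linarith
  exact hmain.of_norm_left

/-- The descent directions of the algorithm agree with the pseudo-gradient up to the order of the
step size. -/
theorem gradient_estimate_isBigO
    (hgame : IsGame μ Ω J g) (hμ : 0 < μ) (hL : 0 < L) (hLip : LipschitzData L Ω J g)
    [Nonempty (Fin n)] (hΩb : Bornology.IsBounded (Set.univ.pi Ω))
    (hη0 : Tendsto η atTop (𝓝 0)) (hx : ∀ t, x t ∈ Set.univ.pi Ω)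
    (hy : ∀ i, (fun t => y t i - aggr g (x t)) =O[atTop] η)
    (hz : ∀ i, (fun t => z t i - adjointState J g i (x t)) =O[atTop] η) (i : Fin n) :
    (fun t => grad1 (J i) (x t i) (y t i) + (hess21 (g i) (x t i) (y t i)).toEuclideanLin (z t i)
      - explicitGrad J g (x t) i) =O[atTop] η := by
  obtain ⟨-, K, hK⟩ := hgame.lipOn_adjointState hμ hL.le hLip hΩb i
  have hxx : (fun t => x t - x t) =O[atTop] η := by simpa using isBigO_zero η atTop
  have h1 := (hLip.lip_J1 i).isBigO_increment hx hx hxx (hy i)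
  have h2 := (hLip.lip_g21 i).isBigO_increment hx hx hxx (hy i)
  obtain ⟨K', hK'⟩ := ((hLip.lip_g21 i).lipOn_comp hL.le
    (hgame.lipOn_aggr hμ hL.le hLip)).exists_bound hΩb
  have h3 : (fun t => (hess21 (g i) (x t i) (aggr g (x t))).toEuclideanLin
      (z t i - adjointState J g i (x t))) =O[atTop] η := by
    refine (IsBigO.of_bound K' (Eventually.of_forall fun t => ?_)).trans (hz i)
    exact (norm_toEuclideanLin_le _ _).trans
      (mul_le_mul_of_nonneg_right (hK' _ (hx t)) (norm_nonneg _))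
  have h4 := isBigO_toEuclideanLin h2 (fun t => hK _ (hx t))
  -- the product of the two errors
  have h5 : (fun t => (hess21 (g i) (x t i) (y t i)
      - hess21 (g i) (x t i) (aggr g (x t))).toEuclideanLin
      (z t i - adjointState J g i (x t))) =O[atTop] η := by
    have hbd : ∀ᶠ t in atTop, ‖hess21 (g i) (x t i) (y t i)
        - hess21 (g i) (x t i) (aggr g (x t))‖ < 1 :=
      (h2.trans_tendsto hη0).norm.eventually (gt_mem_nhds (by simp))
    refine (IsBigO.of_bound 1 ?_).trans (hz i)
    filter_upwards [hbd] with t ht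
    exact (norm_toEuclideanLin_le _ _).trans (mul_le_mul_of_nonneg_right ht.le (norm_nonneg _))
  refine (((h1.add h3).add h4).add h5).congr_left fun t => ?_
  rw [explicitGrad]
  simp only [map_sub, LinearMap.sub_apply]
  abel

end Run

/-! ### Convergence of the actions -/

section Actions

variable {n m₁ m₂ : ℕ} {μ L θ : ℝ} {Ω : Fin n → Set (E m₁)} {J g : Fin n → E m₁ → E m₂ → ℝ}

theorem pos_of_lt_div {k θ ℓ : ℝ} (hθ : 0 < θ) (hk : 0 < k) (h : k < θ / ℓ) : 0 < ℓ := by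
  by_contra hc
  push Not at hc
  linarith [div_nonpos_of_nonneg_of_nonpos hθ.le hc]

/-- The pseudo-gradient as a map of profiles. -/
noncomputable def profileGrad (J g : Fin n → E m₁ → E m₂ → ℝ) (X : Profile n m₁) : Profile n m₁ :=
  WithLp.toLp 2 (explicitGrad J g (WithLp.ofLp X))

theorem IsGame.profileGrad_monotone (hgame : IsGame μ Ω J g) (hμ : 0 < μ) (hL : 0 ≤ L)
    (hLip : LipschitzData L Ω J g) [Nonempty (Fin n)] (hΩc : ∀ i, Convex ℝ (Ω i))
    (hmono : StronglyMonotone θ Ω (pseudoGrad Ω J g)) :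
    ∀ X ∈ profileSet Ω, ∀ Y ∈ profileSet Ω,
      θ * ‖X - Y‖ ^ 2 ≤ inner ℝ (profileGrad J g X - profileGrad J g Y) (X - Y) := by
  intro X hX Y hY
  rw [Profile.norm_sq_eq_sum, Profile.inner_eq]
  exact hgame.explicitGrad_monotone hμ hL hLip hΩc hmono _ (fun i _ => hX i) _ (fun i _ => hY i)

theorem IsGame.lipOn_profileGrad (hgame : IsGame μ Ω J g) (hμ : 0 < μ) (hL : 0 ≤ L)
    (hLip : LipschitzData L Ω J g) [Nonempty (Fin n)] (hΩ : Bornology.IsBounded (Set.univ.pi Ω)) :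
    LipOn (profileSet Ω) (profileGrad J g) := by
  choose C hC h using fun i => hgame.lipOn_explicitGrad hμ hL hLip hΩ i
  refine ⟨∑ i, C i, Finset.sum_nonneg fun i _ => hC i, fun X hX Y hY => ?_⟩
  refine (Profile.norm_le_sum _).trans ?_
  rw [Finset.sum_mul]
  refine Finset.sum_le_sum fun i _ => ?_
  exact (h i _ (fun i _ => hX i) _ (fun i _ => hY i)).trans
    (mul_le_mul_of_nonneg_left (Profile.pi_norm_le (X - Y)) (hC i))

theorem IsGame.isStackelberg_iff_isVISol (hgame : IsGame μ Ω J g) (hμ : 0 < μ) (hL : 0 ≤ L)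
    (hLip : LipschitzData L Ω J g) [Nonempty (Fin n)] (hΩc : ∀ i, Convex ℝ (Ω i))
    {x : Fin n → E m₁} {y : E m₂} :
    IsStackelberg Ω J g x y ↔
      IsVISol (profileSet Ω) (profileGrad J g) (WithLp.toLp 2 x) ∧ y = aggr g x := by
  rw [hgame.isStackelberg_iff hμ hL hLip hΩc]
  constructor
  · rintro ⟨hx, hy, hvi⟩
    refine ⟨⟨fun i => hx i trivial, fun q hq => ?_⟩, hy⟩
    rw [Profile.inner_eq]
    exact Finset.sum_nonneg fun i _ => hvi i _ (hq i)
  · rintro ⟨⟨hx, hvi⟩, hy⟩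
    refine ⟨fun i _ => hx i, hy, fun i u hu => ?_⟩
    -- test the joint inequality with a unilateral deviation
    have h := hvi (WithLp.toLp 2 (Function.update x i u)) fun j => by
      rcases eq_or_ne j i with rfl | hj
      · simpa using hu
      · simpa [hj] using hx j
    rw [Profile.inner_eq, Finset.sum_eq_single i] at h
    · simpa [profileGrad] using h
    · intro j _ hj
      simp [hj]
    · intro hi; exact absurd (Finset.mem_univ i) hi

end Actions

end SOGD

theorem theorem1 {n m₁ m₂ : ℕ}
    -- the game
    (Ω : Fin n → Set (SOGD.E m₁)) (J g : Fin n → SOGD.E m₁ → SOGD.E m₂ → ℝ)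
    (μ L θ : ℝ) (hμ : 0 < μ) (hL : 0 < L) (hθ : 0 < θ)
    (hgame : SOGD.IsGame μ Ω J g)
    (hΩne : ∀ i, (Ω i).Nonempty) (hΩconv : ∀ i, Convex ℝ (Ω i)) (hΩcomp : ∀ i, IsCompact (Ω i))
    (hLip : SOGD.LipschitzData L Ω J g)
    (hmono : SOGD.StronglyMonotone θ Ω (SOGD.pseudoGrad Ω J g))
    -- the network
    (A : Matrix (Fin n) (Fin n) ℝ) (hA : SOGD.IsNetwork A)
    -- a run of the algorithm with step-size `b / (t + a)`
    (κ α k a b : ℝ)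
    (x : ℕ → Fin n → SOGD.E m₁) (y lam : ℕ → Fin n → SOGD.E m₂)
    (v : ℕ → Fin n → Matrix (Fin m₂) (Fin m₂) ℝ) (z : ℕ → Fin n → SOGD.E m₂)
    (hrun : SOGD.IsRun Ω J g A κ α k (fun t => b / (t + a)) x y lam v z)
    -- the bounds: any bounds valid on `Ω i × Y`, `Y` containing the points `y t i` and `σ(∏ Ω i)`,
    -- qualify
    (K₀ K₁ K₃ : ℝ) (hK₀pos : 0 < K₀)
    (hK₀ : ∀ t i, ‖SOGD.hess22 (g i) (x t i) (y t i)‖ ≤ K₀)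
    (hK₁ : ∀ w ∈ Set.univ.pi Ω, ∀ i, ‖SOGD.grad2 (J i) (w i) (SOGD.aggr g w)‖ ≤ K₁)
    (hK₃ : ∀ w ∈ Set.univ.pi Ω, ∀ i, ‖SOGD.hess21 (g i) (w i) (SOGD.aggr g w)‖ ≤ K₃)
    -- the conditions on the parameters; `κ < μ / λ_n(I - A)²` is written without division
    (hκ : 0 < κ) (hκL : κ < 1 / L) (hκμ : ∀ l ∈ spectrum ℝ (1 - A), κ * l ^ 2 < μ)
    (hα : 0 < α) (hαK : α < μ / (2 * n * K₀ ^ 2))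
    (hk : 0 < k) (hkθ : k < θ / SOGD.lipConst n L μ K₁ K₃)
    (ha : max (2 * k * (θ - k * SOGD.lipConst n L μ K₁ K₃) * b) b < a)
    (hb : max (1 / (2 * k * (θ - k * SOGD.lipConst n L μ K₁ K₃))) 1 ≤ b) :
    ∃ xs : Fin n → SOGD.E m₁,
      -- `(xs, σ(xs))` is the unique Stackelberg equilibrium
      SOGD.IsStackelberg Ω J g xs (SOGD.aggr g xs) ∧
      (∀ x' y', SOGD.IsStackelberg Ω J g x' y' → x' = xs ∧ y' = SOGD.aggr g xs) ∧
      -- convergence of the actions (Euclidean norm on the product) and of the estimates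
      Tendsto (fun t => ‖WithLp.toLp 2 (x t - xs)‖) atTop (𝓝 0) ∧
      (fun t => ‖WithLp.toLp 2 (x t - xs)‖) =O[atTop] (fun t : ℕ => √(Real.log t / t)) ∧
      (∀ i, Tendsto (fun t => ‖y t i - SOGD.aggr g xs‖) atTop (𝓝 0) ∧
        (fun t => ‖y t i - SOGD.aggr g xs‖) =O[atTop] (fun t : ℕ => √(Real.log t / t))) := by
  open SOGD in
  have := hA.nonempty
  -- as `0 < ℓ` and `k ℓ < θ`, the bound on `b` gives `1 ≤ 2kθb`
  set ℓ := lipConst n L μ K₁ K₃ with hℓ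
  have hℓ0 : 0 < ℓ := pos_of_lt_div hθ hk hkθ
  have hkℓ : k * ℓ < θ := (lt_div_iff₀ hℓ0).1 hkθ
  have hb1 : 1 ≤ b := (le_max_right _ _).trans hb
  have hab : b < a := (le_max_right _ _).trans_lt ha
  have hbk : 1 ≤ 2 * k * θ * b := by
    have h1 : 1 / (2 * k * (θ - k * ℓ)) ≤ b := (le_max_left _ _).trans hb
    have h2 : 0 < 2 * k * (θ - k * ℓ) := mul_pos (by positivity) (by linarith)
    rw [div_le_iff₀ h2] at h1
    have h3 : b * (2 * k * (θ - k * ℓ)) ≤ b * (2 * k * θ) := by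
      refine mul_le_mul_of_nonneg_left (mul_le_mul_of_nonneg_left ?_ (by positivity)) (by linarith)
      linarith [mul_pos hk hℓ0]
    linarith
  have hκL' : κ * L < 1 := (lt_div_iff₀ hL).1 hκL
  set η : ℕ → ℝ := fun t => b / ((t : ℝ) + a) with hη
  have hηpos : ∀ t, 0 < η t := step_pos hb1 hab
  have hη0 : Tendsto η atTop (𝓝 0) := tendsto_step a b
  have hηlim : Tendsto (fun t => η (t + 1) / η t) atTop (𝓝 1) := tendsto_step_ratio hb1 hab
  -- the sets
  have hP : ∀ i, IsConvexProj (Ω i) (proj (Ω i)) := fun i =>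
    isConvexProj_proj (hΩne i) (hΩconv i) (hΩcomp i)
  have hΩb : Bornology.IsBounded (Set.univ.pi Ω) := (isCompact_univ_pi hΩcomp).isBounded
  have hScomp := isCompact_profileSet hΩcomp
  have hSconv := convex_profileSet hΩconv
  have hSne : (profileSet Ω).Nonempty :=
    ⟨WithLp.toLp 2 fun i => (hΩne i).some, fun i => (hΩne i).some_mem⟩
  have hPS := isConvexProj_profile hP
  have hmonoS := hgame.profileGrad_monotone hμ hL.le hLip hΩconv hmono
  have hlipS := hgame.lipOn_profileGrad hμ hL.le hLip hΩb
  obtain ⟨M, hM⟩ := hlipS.exists_bound hScomp.isBounded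
  obtain ⟨D, hD⟩ := Metric.isBounded_iff.1 hScomp.isBounded
  have hDiam : ∀ X ∈ profileSet Ω, ∀ Y ∈ profileSet Ω, ‖X - Y‖ ≤ |D| := fun X hX Y hY => by
    rw [← dist_eq_norm]; exact (hD hX hY).trans (le_abs_self D)
  obtain ⟨C, hC, hCS⟩ := hlipS
  -- the equilibrium
  obtain ⟨Xs, hXs⟩ := exists_isVISol (ℒ := C + 1) hPS hθ hScomp hSne (fun X hX Y hY =>
    (hCS X hX Y hY).trans (mul_le_mul_of_nonneg_right (by linarith) (norm_nonneg _)))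
    (by linarith) hmonoS
  -- the run
  have hx : ∀ t, x t ∈ Set.univ.pi Ω := hrun.mem hP hΩconv hηpos fun t => (step_lt_one hb1 hab t).le
  have hinc := hrun.x_increment hP (fun i => (hΩcomp i).isBounded) hx
  have hy := hrun.y_tracking hgame hμ hL hLip hA hκ hκL' hκμ hηpos hηlim hx hinc
  have hσ := hgame.lipOn_aggr hμ hL.le hLip
  have hyinc : ∀ i, (fun t => y (t + 1) i - y t i) =O[atTop] η := by
    intro i
    refine (((isBigO_shift hηlim hηpos (hy i)).sub (hy i)).add
      ((hσ.isBigO_comp (fun t => hx (t + 1)) hx).trans hinc)).congr_left fun t => ?_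
    abel
  have hv := hrun.v_tracking hLip hA hηpos hηlim hx hinc hyinc
  have hz := hrun.z_tracking hgame hμ hL hLip hΩb hK₀pos hK₀ hα hαK hηpos hηlim hη0 hx hinc hy hv
  have hgrad := gradient_estimate_isBigO hgame hμ hL hLip hΩb hη0 hx hy hz
  have hX2 : (fun t => ‖(WithLp.toLp 2 (x t) : Profile n m₁) - Xs‖ ^ 2) =O[atTop]
      fun t : ℕ => Real.log t / t := by
    refine isBigO_of_projected_steps (p := fun t => WithLp.toLp 2 fun i => proj (Ω i) (x t i - k •
      (grad1 (J i) (x t i) (y t i) + (hess21 (g i) (x t i) (y t i)).toEuclideanLin (z t i))))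
      hPS hk hθ hSconv hC (abs_nonneg D) hb1 hbk hab hCS hM hDiam hmonoS hXs
      (fun t i => hx t i trivial) (fun t i => (hP i _).1) (isBigO_profile fun i => ?_) fun t => ?_
    · refine (IsBigO.of_bound k (Eventually.of_forall fun t => ?_)).trans (hgrad i)
      refine ((hP i).norm_sub_le _ _).trans (le_of_eq ?_)
      rw [← norm_neg]
      have e : ∀ u w c : E m₁, -(u - k • w - (u - k • c)) = k • (w - c) := fun u w c => by module
      refine (congrArg norm (e _ _ _)).trans ?_
      rw [norm_smul, Real.norm_of_nonneg hk.le]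
      rfl
    · ext1 i
      have h := hrun.x_succ t i
      simp only [PiLp.add_apply, PiLp.smul_apply, PiLp.sub_apply]
      rw [h]
      module
  have hXO : (fun t => ‖(WithLp.toLp 2 (x t) : Profile n m₁) - Xs‖) =O[atTop]
      fun t : ℕ => √(Real.log t / t) := by
    obtain ⟨c, hc⟩ := hX2.bound
    refine IsBigO.of_bound (√c) ?_
    filter_upwards [hc, eventually_ge_atTop 1] with t ht ht1
    have h0 : 0 ≤ Real.log t / t :=
      div_nonneg (Real.log_nonneg (by exact_mod_cast ht1)) t.cast_nonneg
    rw [Real.norm_of_nonneg (sq_nonneg _), Real.norm_of_nonneg h0] at ht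
    rw [norm_norm, Real.norm_of_nonneg (Real.sqrt_nonneg _), ← Real.sqrt_mul' _ h0]
    exact Real.le_sqrt_of_sq_le ht
  have hrate : Tendsto (fun t : ℕ => √(Real.log t / t)) atTop (𝓝 0) := by
    have h := (Real.continuous_sqrt.tendsto 0).comp tendsto_log_div_nat
    rwa [Real.sqrt_zero] at h
  have hXsmem : WithLp.ofLp Xs ∈ Set.univ.pi Ω := fun i _ => hXs.1 i
  refine ⟨WithLp.ofLp Xs, ?_, ?_, hXO.trans_tendsto hrate, hXO, fun i => ?_⟩
  · exact (hgame.isStackelberg_iff_isVISol hμ hL.le hLip hΩconv).2 ⟨hXs, rfl⟩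
  · intro x' y' h'
    obtain ⟨h1, rfl⟩ := (hgame.isStackelberg_iff_isVISol hμ hL.le hLip hΩconv).1 h'
    have h2 := congrArg WithLp.ofLp (h1.unique hθ hmonoS hXs)
    exact ⟨h2, congrArg (aggr g) h2⟩
  · have h1 : (fun t => aggr g (x t) - aggr g (WithLp.ofLp Xs)) =O[atTop]
        fun t : ℕ => √(Real.log t / t) := by
      refine (hσ.isBigO_comp hx fun _ => hXsmem).trans (IsBigO.trans ?_ hXO)
      refine IsBigO.of_bound 1 (Eventually.of_forall fun t => ?_)
      rw [one_mul, norm_norm]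
      exact Profile.pi_norm_le (WithLp.toLp 2 (x t) - Xs)
    have h2 : (fun t => ‖y t i - aggr g (WithLp.ofLp Xs)‖) =O[atTop]
        fun t : ℕ => √(Real.log t / t) := by
      refine IsBigO.norm_left ?_
      refine (((hy i).trans (step_isBigO_sqrt hb1 hab)).add h1).congr_left fun t => ?_
      abel
    exact ⟨h2.trans_tendsto hrate, h2⟩
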